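/- Work in the category $\mathbf{kTop}$ of $k$-spaces; for a topological space $X$ let $\mathrm{k}X$ denote $X$ with the final topology with respect to all continuous maps from compact Hausdorff spaces to $X$ ($X$ is a $k$-space if $\mathrm{k}X=X$). Let $G$ be a contractible topological group whose underlying space is metrisable, or locally compact, or a Hausdorff $k_\omega$-space (i.e. Hausdorff and the direct limit of an ascending sequence of compact subspaces). Let $V$ be a $G$-module in $\mathbf{kTop}$: an abelian group with a $k$-space topology such that negation is continuous and addition is continuous as a map $\mathrm{k}(V\times V)\to V$, together with an action of $G$ on $V$ by group automorphisms such that $\mathrm{k}(G\times V)\to V$ is continuous. For $n\ge 0$ let $A^n(G;V)$ be the group of all maps $G^{n+1}\to V$, with the differential $(df)(x_0,\dots,x_{n+1})=\sum_{i=0}^{n+1}(-1)^i f(x_0,\dots,\widehat{x_i},\dots,x_{n+1})$, and call $f$ equivariant if $f(gx_0,\dots,gx_n)=g\cdot f(x_0,\dots,x_n)$ for all $g,x_0,\dots,x_n\in G$. Let $A_{kc}^n(G;V)=C(\mathrm{k}G^{n+1},V)$, and let $A_{kcg}^n(G;V)$ be the group of those $f\in A^n(G;V)$ for which there is an open covering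 $\mathfrak U$ of $G$ such that $f$ is continuous on $\mathrm{k}\,\mathfrak U[n]$, where $\mathfrak U[n]=\bigcup_{U\in\mathfrak U}U^{n+1}$ (homogeneous cochains with continuous germ at the diagonal). Let $A_{kc}^*(G;V)^G\subseteq A_{kcg}^*(G;V)^G$ be the subcomplexes of equivariant cochains, with cohomology $H_{kc,eq}^*(G;V)$ (the continuous group cohomology in $\mathbf{kTop}$) and $H_{kcg,eq}^*(G;V)$ respectively. Then for every $n\ge 0$ the inclusion $A_{kc}^*(G;V)^G\hookrightarrow A_{kcg}^*(G;V)^G$ induces an isomorphism $$H_{kc,eq}^n(G;V)\;\cong\;H_{kcg,eq}^n(G;V).$$ -/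

import Mathlib

open CategoryTheory

universe u

namespace KCohomology

/-! ### The category of `k`-spaces -/

/-- `f` is continuous on the `k`-ification `kX` of `X`, i.e. on `X` with the final topology
with respect to all continuous maps from compact Hausdorff spaces to `X`. -/
def KContinuous {X Y : Type u} [TopologicalSpace X] [TopologicalSpace Y] (f : X → Y) : Prop :=
  @Continuous X Y (TopologicalSpace.compactlyGenerated.{u} X) _ f

theorem kContinuous_iff {X Y : Type u} [TopologicalSpace X] [TopologicalSpace Y] (f : X → Y) :
    KContinuous f ↔ ∀ (S : CompHaus.{u}) (g : C(S, X)), Continuous (f ∘ g) := by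
  constructor
  · intro h S g
    have h1 : ∀ (i : (S : CompHaus.{u}) × C(S, X)),
        Continuous fun s : i.fst => f (i.snd s) := by
      have h2 := continuous_coinduced_dom.1 h
      exact fun i => continuous_sigma_iff.1 h2 i
    exact h1 ⟨S, g⟩
  · exact continuous_from_compactlyGenerated f

theorem KContinuous.of_continuous {X Y : Type u} [TopologicalSpace X] [TopologicalSpace Y]
    {f : X → Y} (hf : Continuous f) : KContinuous f :=
  (kContinuous_iff f).2 fun _ g => hf.comp g.continuous

theorem KContinuous.comp_continuous {X Y Z : Type u} [TopologicalSpace X] [TopologicalSpace Y]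
    [TopologicalSpace Z] {f : Y → Z} (hf : KContinuous f) {g : X → Y} (hg : Continuous g) :
    KContinuous (f ∘ g) :=
  (kContinuous_iff _).2 fun S c =>
    (kContinuous_iff f).1 hf S ⟨g ∘ c, hg.comp c.continuous⟩

/-- Abelian `k`-groups: abelian group objects in the category of `k`-spaces. The addition is
required to be continuous on the product `k(V × V)` of that category. -/
class IsKAddGroup (V : Type u) [TopologicalSpace V] [AddCommGroup V] : Prop where
  isKSpace : UCompactlyGeneratedSpace.{u} V
  kContinuous_add : KContinuous fun p : V × V => p.1 + p.2
  continuous_neg : Continuous fun v : V => -v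

/-- `G`-modules in the category of `k`-spaces: the abelian `k`-group `V` carries an action of `G`
by automorphisms which is continuous on the product `k(G × V)` of that category. -/
class IsKModule (G V : Type u) [TopologicalSpace G] [Group G] [TopologicalSpace V]
    [AddCommGroup V] [IsKAddGroup V] [DistribMulAction G V] : Prop where
  kContinuous_smul : KContinuous fun p : G × V => p.1 • p.2

/-- `X` is a `k_ω`-space: it is the direct limit of an ascending sequence of compact subspaces. -/
def IsKOmegaSpace (X : Type u) [TopologicalSpace X] : Prop :=
  ∃ K : ℕ → Set X, Monotone K ∧ (∀ m, IsCompact (K m)) ∧ (⋃ m, K m) = Set.univ ∧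
    ∀ A : Set X, (∀ m, IsOpen (((↑) : K m → X) ⁻¹' A)) → IsOpen A

theorem KContinuous.add {X V : Type u} [TopologicalSpace X] [TopologicalSpace V] [AddCommGroup V]
    [IsKAddGroup V] {f g : X → V} (hf : KContinuous f) (hg : KContinuous g) :
    KContinuous (f + g) :=
  (kContinuous_iff _).2 fun S c =>
    (kContinuous_iff _).1 (IsKAddGroup.kContinuous_add (V := V)) S
      ⟨fun s => (f (c s), g (c s)),
        ((kContinuous_iff f).1 hf S c).prodMk ((kContinuous_iff g).1 hg S c)⟩

theorem KContinuous.neg {X V : Type u} [TopologicalSpace X] [TopologicalSpace V] [AddCommGroup V]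
    [IsKAddGroup V] {f : X → V} (hf : KContinuous f) : KContinuous (-f) :=
  (kContinuous_iff _).2 fun S c =>
    (IsKAddGroup.continuous_neg (V := V)).comp ((kContinuous_iff f).1 hf S c)

/-- The additive group `C(kX, V)` of continuous maps on the `k`-ification of `X`. -/
def kContinuousMaps (X V : Type u) [TopologicalSpace X] [TopologicalSpace V] [AddCommGroup V]
    [IsKAddGroup V] : AddSubgroup (X → V) where
  carrier := {f | KContinuous f}
  zero_mem' := KContinuous.of_continuous continuous_const
  add_mem' := KContinuous.add
  neg_mem' := KContinuous.neg

/-! ### The standard complex -/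

/-- The group `A^n(X; V)` of all maps `X^{n+1} → V`. -/
abbrev Cochain (X V : Type u) (n : ℕ) : Type u := (Fin (n + 1) → X) → V

/-- The differential of the standard complex,
`(d f)(x₀, …, x_{n+1}) = ∑ i, (-1)^i f(x₀, …, x̂ᵢ, …, x_{n+1})`. -/
def diff (X V : Type u) [AddCommGroup V] (n : ℕ) : Cochain X V n →+ Cochain X V (n + 1) where
  toFun f := ∑ i : Fin (n + 2), (-1 : ℤ) ^ (i : ℕ) • fun x => f (x ∘ i.succAbove)
  map_zero' := by
    funext x
    simp
  map_add' f g := by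
    funext x
    simp [Finset.sum_add_distrib]

theorem diff_apply {X V : Type u} [AddCommGroup V] {n : ℕ} (f : Cochain X V n)
    (x : Fin (n + 2) → X) :
    diff X V n f x = ∑ i : Fin (n + 2), (-1 : ℤ) ^ (i : ℕ) • f (x ∘ i.succAbove) := by
  simp [diff]

theorem diff_diff {X V : Type u} [AddCommGroup V] {n : ℕ} (f : Cochain X V n) :
    diff X V (n + 1) (diff X V n f) = 0 := by
  funext x
  simp only [diff_apply, Finset.smul_sum, ← Finset.sum_product', Finset.univ_product_univ,
    Pi.zero_apply, smul_smul]
  refine Finset.sum_involution (fun p _ => (p.1.succAbove p.2, p.2.predAbove p.1)) ?_ ?_ ?_ ?_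
  · rintro ⟨i, j⟩ -
    have h : (x ∘ (i.succAbove j).succAbove) ∘ (j.predAbove i).succAbove
        = (x ∘ i.succAbove) ∘ j.succAbove := by
      funext k
      simp only [Function.comp_apply]
      rw [Fin.succAbove_succAbove_succAbove_predAbove]
    dsimp only
    rw [h, ← add_smul]
    convert zero_smul ℤ _
    rw [← pow_add, ← pow_add, Fin.neg_one_pow_succAbove_add_predAbove, pow_add]
    ring
  · rintro ⟨i, j⟩ - - h
    exact Fin.succAbove_ne i j (congrArg Prod.fst h)
  · intros
    exact Finset.mem_univ _
  · rintro ⟨i, j⟩ -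
    simp only [Fin.succAbove_succAbove_predAbove, Prod.mk.injEq, true_and]
    exact Fin.predAbove_predAbove_succAbove _ _

/-- A subcomplex of the standard complex `A^*(X; V)`. -/
structure Subcomplex (X V : Type u) [AddCommGroup V] where
  carrier : ∀ n, AddSubgroup (Cochain X V n)
  diff_mem : ∀ n, ∀ f ∈ carrier n, diff X V n f ∈ carrier (n + 1)

namespace Subcomplex

variable {X V : Type u} [AddCommGroup V]

/-- A subcomplex of the standard complex as a cochain complex of abelian groups. -/
noncomputable def complex (A : Subcomplex X V) : CochainComplex AddCommGrpCat.{u} ℕ :=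
  CochainComplex.of (fun n => AddCommGrpCat.of (A.carrier n))
    (fun n => AddCommGrpCat.ofHom
      (((diff X V n).comp (A.carrier n).subtype).codRestrict (A.carrier (n + 1))
        fun f => A.diff_mem n f f.2))
    (fun n => by
      refine AddCommGrpCat.hom_ext (AddMonoidHom.ext fun f => ?_)
      exact Subtype.ext (diff_diff f.1))

/-- The cochain map given by the inclusion of one subcomplex in another. -/
noncomputable def inclusion {A B : Subcomplex X V} (h : ∀ n, A.carrier n ≤ B.carrier n) :
    A.complex ⟶ B.complex :=
  CochainComplex.ofHom
    (fun n => AddCommGrpCat.ofHom (AddSubgroup.inclusion (h n)))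
    (fun n => by
      simp only [complex, CochainComplex.of_d]
      rfl)

/-- The intersection of two subcomplexes. -/
def inter (A B : Subcomplex X V) : Subcomplex X V where
  carrier n := A.carrier n ⊓ B.carrier n
  diff_mem n f hf := ⟨A.diff_mem n f hf.1, B.diff_mem n f hf.2⟩

end Subcomplex

/-- The subcomplex `A^*(X; V)^G` of `G`-equivariant cochains: the fixed points of the action
`(g.f)(x) = g.f(g⁻¹.x)`, where `G` acts diagonally on `X^{n+1}`. -/
def equivariant (G X V : Type u) [Group G] [MulAction G X] [AddCommGroup V]
    [DistribMulAction G V] : Subcomplex X V where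
  carrier n :=
    { carrier := {f | ∀ (g : G) (x : Fin (n + 1) → X), f (g • x) = g • f x}
      zero_mem' := fun g x => (smul_zero g).symm
      add_mem' := fun {a b} ha hb g x => by
        simp only [Pi.add_apply, smul_add, ha g x, hb g x]
      neg_mem' := fun {a} ha g x => by
        simp only [Pi.neg_apply, smul_neg, ha g x] }
  diff_mem n f hf g x := by
    rw [diff_apply, diff_apply, Finset.smul_sum]
    refine Finset.sum_congr rfl fun i _ => ?_
    rw [smul_comm]
    exact congrArg _ (hf g (x ∘ i.succAbove))

section Continuity

variable {X V : Type u} [TopologicalSpace X]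

/-- For a family `U` of subsets of `X`, the set `U[n] = ⋃_{A ∈ U} A^{n+1}` in `X^{n+1}`. -/
def diagNhd (U : Set (Set X)) (n : ℕ) : Set (Fin (n + 1) → X) :=
  {x | ∃ A ∈ U, ∀ i, x i ∈ A}

/-- Open coverings of `X`. -/
structure IsOpenCover (U : Set (Set X)) : Prop where
  isOpen : ∀ A ∈ U, IsOpen A
  sUnion_eq : ⋃₀ U = Set.univ

/-- The common refinement of two families of sets. -/
def meetCover (U W : Set (Set X)) : Set (Set X) := {A | ∃ B ∈ U, ∃ C ∈ W, A = B ∩ C}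

theorem IsOpenCover.meet {U W : Set (Set X)} (hU : IsOpenCover U) (hW : IsOpenCover W) :
    IsOpenCover (meetCover U W) := by
  refine ⟨?_, ?_⟩
  · rintro _ ⟨B, hB, C, hC, rfl⟩
    exact (hU.isOpen B hB).inter (hW.isOpen C hC)
  · refine Set.eq_univ_of_forall fun x => ?_
    obtain ⟨B, hB, hxB⟩ := Set.mem_sUnion.1 (hU.sUnion_eq ▸ Set.mem_univ x)
    obtain ⟨C, hC, hxC⟩ := Set.mem_sUnion.1 (hW.sUnion_eq ▸ Set.mem_univ x)
    exact ⟨B ∩ C, ⟨B, hB, C, hC, rfl⟩, hxB, hxC⟩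

theorem isOpenCover_univ : IsOpenCover ({Set.univ} : Set (Set X)) :=
  ⟨by simp, by simp⟩

variable [TopologicalSpace V]

/-- `f` is continuous on the `k`-ification of the subspace `s` of its domain. -/
def KContinuousOn {Y : Type u} [TopologicalSpace Y] (f : Y → V) (s : Set Y) : Prop :=
  KContinuous fun y : s => f y

theorem KContinuousOn.comp_mapsTo {Y Z : Type u} [TopologicalSpace Y] [TopologicalSpace Z]
    {f : Z → V} {s : Set Z} (hf : KContinuousOn f s) {g : Y → Z} (hg : Continuous g) {t : Set Y}
    (h : Set.MapsTo g t s) : KContinuousOn (f ∘ g) t :=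
  KContinuous.comp_continuous hf (g := h.restrict g t s)
    ((hg.comp continuous_subtype_val).subtype_mk _)

theorem KContinuousOn.mono {Y : Type u} [TopologicalSpace Y] {f : Y → V} {s t : Set Y}
    (hf : KContinuousOn f s) (h : t ⊆ s) : KContinuousOn f t :=
  hf.comp_mapsTo continuous_id h

end Continuity

section Complexes

variable (X V : Type u) [TopologicalSpace X] [TopologicalSpace V] [AddCommGroup V] [IsKAddGroup V]

/-- The continuous standard complex `A_{kc}^*(X; V) = C(k X^{*+1}, V)` in the category of
`k`-spaces. -/
def kcSubcomplex : Subcomplex X V where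
  carrier n := kContinuousMaps (Fin (n + 1) → X) V
  diff_mem n f hf := by
    change ∑ i : Fin (n + 2), (-1 : ℤ) ^ (i : ℕ) • (fun x => f (x ∘ i.succAbove)) ∈ _
    refine AddSubgroup.sum_mem _ fun i _ => AddSubgroup.zsmul_mem _ ?_ _
    exact KContinuous.comp_continuous hf (continuous_pi fun j => continuous_apply _)

/-- The complex `A_{kcg}^*(X; V)` of cochains with continuous germ at the diagonal: those `f` for
which there is an open covering `U` of `X` such that `f` is continuous on `k U[n]`. -/
def kcgSubcomplex : Subcomplex X V where
  carrier n :=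
    { carrier := {f | ∃ U : Set (Set X), IsOpenCover U ∧ KContinuousOn f (diagNhd U n)}
      zero_mem' := ⟨_, isOpenCover_univ, KContinuous.of_continuous continuous_const⟩
      add_mem' := by
        rintro f g ⟨U, hU, hf⟩ ⟨W, hW, hg⟩
        refine ⟨meetCover U W, hU.meet hW, ?_⟩
        have hf' : KContinuousOn f (diagNhd (meetCover U W) n) := hf.mono <| by
          rintro x ⟨_, ⟨B, hB, C, hC, rfl⟩, hx⟩
          exact ⟨B, hB, fun i => (hx i).1⟩
        have hg' : KContinuousOn g (diagNhd (meetCover U W) n) := hg.mono <| by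
          rintro x ⟨_, ⟨B, hB, C, hC, rfl⟩, hx⟩
          exact ⟨C, hC, fun i => (hx i).2⟩
        exact KContinuous.add hf' hg'
      neg_mem' := by
        rintro f ⟨U, hU, hf⟩
        exact ⟨U, hU, KContinuous.neg hf⟩ }
  diff_mem := by
    rintro n f ⟨U, hU, hf⟩
    refine ⟨U, hU, ?_⟩
    have h : (fun y : diagNhd U (n + 1) => diff X V n f y)
        ∈ kContinuousMaps (diagNhd U (n + 1)) V := by
      have h1 : (fun y : diagNhd U (n + 1) => diff X V n f y)
          = ∑ i : Fin (n + 2), (-1 : ℤ) ^ (i : ℕ) •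
            fun y : diagNhd U (n + 1) => f (y.1 ∘ i.succAbove) := by
        funext y
        simp [diff_apply]
      rw [h1]
      refine AddSubgroup.sum_mem _ fun i _ => AddSubgroup.zsmul_mem _ ?_ _
      refine hf.comp_mapsTo (g := fun x => x ∘ i.succAbove)
        (continuous_pi fun j => continuous_apply _) ?_
      rintro x ⟨A, hA, hx⟩
      exact ⟨A, hA, fun j => hx _⟩
    exact h

theorem kc_le_kcg (n : ℕ) : (kcSubcomplex X V).carrier n ≤ (kcgSubcomplex X V).carrier n :=
  fun _ hf => ⟨_, isOpenCover_univ, KContinuous.comp_continuous hf continuous_subtype_val⟩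

end Complexes

section Cohomology

variable (G X V : Type u) [Group G] [TopologicalSpace X] [MulAction G X]
  [TopologicalSpace V] [AddCommGroup V] [IsKAddGroup V] [DistribMulAction G V]

/-- The complex `A_{kc}^*(X; V)^G` of continuous equivariant cochains. -/
def kcEq : Subcomplex X V := (kcSubcomplex X V).inter (equivariant G X V)

/-- The complex `A_{kcg}^*(X; V)^G` of equivariant cochains with continuous germ at the
diagonal. -/
def kcgEq : Subcomplex X V := (kcgSubcomplex X V).inter (equivariant G X V)

/-- The inclusion `A_{kc}^*(X; V)^G ⟶ A_{kcg}^*(X; V)^G`. -/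
noncomputable def kcEqInclusion : (kcEq G X V).complex ⟶ (kcgEq G X V).complex :=
  Subcomplex.inclusion fun n => inf_le_inf_right _ (kc_le_kcg X V n)

/-- The cohomology group `H_{kc,eq}^n(X; V)`. -/
noncomputable abbrev Hkc (n : ℕ) : AddCommGrpCat.{u} := (kcEq G X V).complex.homology n

/-- The cohomology group `H_{kcg,eq}^n(X; V)`. -/
noncomputable abbrev Hkcg (n : ℕ) : AddCommGrpCat.{u} := (kcgEq G X V).complex.homology n

/-- The map `H_{kc,eq}^n(X; V) ⟶ H_{kcg,eq}^n(X; V)` induced by the inclusion. -/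
noncomputable abbrev HkcToHkcg (n : ℕ) : Hkc G X V n ⟶ Hkcg G X V n :=
  HomologicalComplex.homologyMap (kcEqInclusion G X V) n

end Cohomology

end KCohomology

/-! The proof compares both complexes with the double complex of equivariant functions `f(x, y)` on
`G^{p+1} × G^{q+1}` that are `k`-continuous near every point `(x, (y, …, y))` (`biCochains`).
Cocycles of the first row in the second variables are functions of `x` alone, that is, continuous
equivariant cochains (`exists_eq_left`). Cocycles of the first column in the first variables are
functions of `y` alone, with continuous germ at the diagonal (`exists_eq_right`).

Exactness in the `x`-direction is formal: inserting `y 0` as a new first variable is an equivariant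
cone (`exists_diffL_eq`). Exactness in the `y`-direction is where contractibility enters
(`exists_diffR_eq`). The translates of one contraction move `y` to `x 0 * c` equivariantly, but a
single prism along it would leave the region where `f` is continuous. The contraction is therefore
cut into steps so short that each prism stays inside that region, and the prism operators are
summed. The step length must depend continuously on `(x, y)`; the topological alternatives for `G`
serve only to provide such a choice (`hasStepFunctions_of_contractible_group`).

The Alexander–Whitney map sends the total complex to cochains with continuous germ. On the `x`-edge
it is the inclusion under study and on the `y`-edge the identity. Moving a cocycle from one edge to
the other by exactness and applying this map gives surjectivity and injectivity
(`exists_kcEq_cohomologous`, `exists_kcEq_of_coboundary`). -/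

namespace KCohomology

open scoped Topology Pointwise unitInterval
open Filter

/-! ### Continuous selection of positive step sizes -/

/-- Any locally bounded-below family of admissible positive step sizes has a continuous
selection. -/
def HasStepFunctions (Z : Type*) [TopologicalSpace Z] : Prop :=
  ∀ S : Z → Set ℝ, (∀ z δ δ', 0 < δ → δ ≤ δ' → δ' ∈ S z → δ ∈ S z) →
    (∀ z, ∃ δ > 0, ∀ᶠ z' in 𝓝 z, δ ∈ S z') →
    ∃ e : Z → ℝ, Continuous e ∧ ∀ z, 0 < e z ∧ e z ∈ S z

theorem hasStepFunctions_of_paracompact (Z : Type*) [TopologicalSpace Z] [NormalSpace Z]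
    [ParacompactSpace Z] : HasStepFunctions Z := by
  intro S hS hloc
  have hconv : ∀ z, Convex ℝ {δ : ℝ | 0 < δ ∧ δ ∈ S z} := by
    intro z
    refine Set.OrdConnected.convex ⟨?_⟩
    rintro a ⟨ha, -⟩ b ⟨-, hb⟩ c ⟨hac, hcb⟩
    exact ⟨ha.trans_le hac, hS z c b (ha.trans_le hac) hcb hb⟩
  obtain ⟨g, hg⟩ := exists_continuous_forall_mem_convex_of_local_const hconv fun z => by
    obtain ⟨δ, hδ, h⟩ := hloc z
    exact ⟨δ, h.mono fun z' h' => ⟨hδ, h'⟩⟩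
  exact ⟨g, g.continuous, hg⟩

/-- Bump functions whose positive values are admissible are combined from a countable subcover with
weights `2^{-(k+1)}`. Since admissibility passes to smaller positive numbers, no partition of unity
is needed. -/
theorem hasStepFunctions_of_lindelof (Z : Type*) [TopologicalSpace Z] [CompletelyRegularSpace Z]
    [LindelofSpace Z] : HasStepFunctions Z := by
  intro S hS hloc
  have key : ∀ z, ∃ (δ : ℝ) (f : Z → ℝ), 0 < δ ∧ δ ≤ 1 ∧ Continuous f ∧ 0 < f z ∧
      (∀ w, 0 ≤ f w ∧ f w ≤ δ) ∧ ∀ w, 0 < f w → f w ∈ S w := by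
    intro z
    obtain ⟨δ, hδ, h⟩ := hloc z
    obtain ⟨W, hW, hWo, hzW⟩ := eventually_nhds_iff.1 h
    obtain ⟨f, hf, hfz, hfW⟩ := CompletelyRegularSpace.completely_regular_isOpen z W hWo hzW
    have hm : 0 < min δ 1 := lt_min hδ one_pos
    -- Truncating at `1` makes the bumps uniformly bounded, so that the weighted series converges
    -- uniformly.
    refine ⟨min δ 1, fun w => min δ 1 * (1 - f w), hm, min_le_right _ _, by fun_prop, ?_, ?_, ?_⟩
    · simp [hfz, hδ]
    · intro w
      have h0 := (f w).2.1
      have h1 := (f w).2.2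
      exact ⟨mul_nonneg hm.le (by linarith), mul_le_of_le_one_right hm.le (by linarith)⟩
    · intro w hw
      have h0 := (f w).2.1
      by_cases hwW : w ∈ W
      · exact hS w _ δ hw ((mul_le_of_le_one_right hm.le (by linarith)).trans (min_le_left _ _))
          (hW w hwW)
      · simp [hfW hwW] at hw
  choose δ f hδ hδ1 hf hfz hfb hfS using key
  obtain hZ | hZ := isEmpty_or_nonempty Z
  · exact ⟨fun _ => 1, continuous_const, fun z => hZ.elim z⟩
  obtain ⟨t, ht, htU⟩ := LindelofSpace.elim_nhds_subcover (fun z => {w | 0 < f z w})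
    (fun z => (isOpen_lt continuous_const (hf z)).mem_nhds (hfz z))
  have htne : t.Nonempty := by
    obtain ⟨z⟩ := hZ
    obtain ⟨i, hi, -⟩ := Set.mem_iUnion₂.1 (htU ▸ Set.mem_univ z)
    exact ⟨i, hi⟩
  obtain ⟨c, rfl⟩ := ht.exists_eq_range htne
  have hsum : Summable fun k : ℕ => (1 / 2 : ℝ) ^ (k + 1) := by
    simpa only [pow_succ] using summable_geometric_two.mul_right (1 / 2 : ℝ)
  have htot : ∑' k : ℕ, (1 / 2 : ℝ) ^ (k + 1) = 1 := by
    have := tsum_geometric_two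
    simp only [pow_succ, tsum_mul_right, this]
    norm_num
  have hle : ∀ k w, f (c k) w ≤ 1 := fun k w => (hfb _ w).2.trans (hδ1 _)
  have hS1 : ∀ w, Summable fun k => (1 / 2 : ℝ) ^ (k + 1) * f (c k) w := fun w =>
    hsum.of_nonneg_of_le (fun k => mul_nonneg (by positivity) (hfb _ w).1)
      (fun k => mul_le_of_le_one_right (by positivity) (hle k w))
  refine ⟨fun w => ∑' k, (1 / 2 : ℝ) ^ (k + 1) * f (c k) w, ?_, fun w => ?_⟩
  · refine continuous_tsum (fun k => continuous_const.mul (hf _)) hsum fun k w => ?_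
    rw [Real.norm_of_nonneg (mul_nonneg (by positivity) (hfb _ w).1)]
    exact mul_le_of_le_one_right (by positivity) (hle k w)
  · obtain ⟨_, ⟨k₀, rfl⟩, hk₀⟩ := Set.mem_iUnion₂.1 (htU ▸ Set.mem_univ w)
    have hpos : 0 < ∑' k, (1 / 2 : ℝ) ^ (k + 1) * f (c k) w :=
      (hS1 w).tsum_pos (fun k => mul_nonneg (by positivity) (hfb _ w).1) k₀
        (mul_pos (by positivity) hk₀)
    refine ⟨hpos, ?_⟩
    -- The weights sum to `1`, so the average cannot exceed all of its terms; a bump that dominates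
    -- it is positive, hence admissible.
    obtain ⟨k, hk⟩ : ∃ k, ∑' k, (1 / 2 : ℝ) ^ (k + 1) * f (c k) w ≤ f (c k) w := by
      by_contra! hlt
      set T := ∑' k, (1 / 2 : ℝ) ^ (k + 1) * f (c k) w with hT
      have h2 : T < ∑' k : ℕ, (1 / 2 : ℝ) ^ (k + 1) * T := by
        rw [hT]
        exact (hS1 w).tsum_lt_tsum (i := 0)
          (fun k => mul_le_mul_of_nonneg_left (hlt k).le (by positivity))
          (mul_lt_mul_of_pos_left (hlt 0) (by positivity)) (hsum.mul_right _)
      rw [tsum_mul_right, htot, one_mul] at h2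
      exact lt_irrefl _ h2
    exact hS w _ _ hpos hk (hfS _ _ (hpos.trans_le hk))

theorem IsKOmegaSpace.sigmaCompactSpace {X : Type u} [TopologicalSpace X] (h : IsKOmegaSpace X) :
    SigmaCompactSpace X := by
  obtain ⟨K, -, hK, hU, -⟩ := h
  exact ⟨⟨K, hK, hU⟩⟩

/-- A connected locally compact group is `σ`-compact, being generated by any compact
neighbourhood of the identity. -/
theorem sigmaCompactSpace_of_connected_locallyCompact_group (G : Type*) [Group G]
    [TopologicalSpace G] [IsTopologicalGroup G] [ConnectedSpace G] [LocallyCompactSpace G] :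
    SigmaCompactSpace G := by
  obtain ⟨K, hK, hK1⟩ := exists_compact_mem_nhds (1 : G)
  have hL : IsCompact (K ∪ K⁻¹) := hK.union hK.inv
  have hpow : ∀ n : ℕ, IsCompact ((K ∪ K⁻¹) ^ n) := by
    intro n
    induction n with
    | zero => simp
    | succ n ih => simpa [pow_succ] using ih.mul hL
  refine ⟨⟨fun n => (K ∪ K⁻¹) ^ n, hpow, ?_⟩⟩
  have hopen : IsOpen (Subgroup.closure K : Set G) :=
    Subgroup.isOpen_of_mem_nhds _ (Filter.mem_of_superset hK1 Subgroup.subset_closure)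
  have huniv : (Subgroup.closure K : Set G) = Set.univ :=
    IsClopen.eq_univ ⟨Subgroup.isClosed_of_isOpen _ hopen, hopen⟩ ⟨1, one_mem _⟩
  refine Set.eq_univ_of_forall fun g => ?_
  have hg : g ∈ Subgroup.closure K := by
    rw [← SetLike.mem_coe, huniv]
    trivial
  refine Subgroup.closure_induction'' (p := fun g _ => g ∈ ⋃ n : ℕ, (K ∪ K⁻¹) ^ n)
    ?_ ?_ ?_ ?_ hg
  · exact fun x hx => Set.mem_iUnion.2 ⟨1, by simp [hx]⟩
  · exact fun x hx => Set.mem_iUnion.2 ⟨1, by simp [hx]⟩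
  · exact Set.mem_iUnion.2 ⟨0, by simp⟩
  · rintro x y - - hx hy
    obtain ⟨n, hn⟩ := Set.mem_iUnion.1 hx
    obtain ⟨m, hm⟩ := Set.mem_iUnion.1 hy
    exact Set.mem_iUnion.2 ⟨n + m, by simpa [pow_add] using Set.mul_mem_mul hn hm⟩

/-- A metrisable group has paracompact normal finite powers. In the other two cases `G` is
`σ`-compact (by connectedness if it is locally compact), so its finite powers are Lindelöf. -/
theorem hasStepFunctions_of_contractible_group {G : Type u} [Group G] [TopologicalSpace G]
    [IsTopologicalGroup G] [ContractibleSpace G]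
    (hG : TopologicalSpace.MetrizableSpace G ∨ LocallyCompactSpace G ∨
      (T2Space G ∧ IsKOmegaSpace G)) (n : ℕ) :
    HasStepFunctions ((Fin n → G) × G) := by
  rcases hG with hG | hG
  · let := TopologicalSpace.metrizableSpaceMetric ((Fin n → G) × G)
    exact hasStepFunctions_of_paracompact _
  · have : SigmaCompactSpace G := by
      rcases hG with hG | hG
      · exact sigmaCompactSpace_of_connected_locallyCompact_group G
      · exact hG.2.sigmaCompactSpace
    -- The group uniformity supplies complete regularity without any separation axiom.
    let := IsTopologicalGroup.rightUniformSpace G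
    exact hasStepFunctions_of_lindelof _

/-! ### Isomorphisms on the cohomology of subcomplexes of the standard complex -/

namespace Subcomplex

variable {X V : Type u} [AddCommGroup V]

theorem complex_d_apply (A : Subcomplex X V) (n : ℕ) (f : A.carrier n) :
    A.complex.d n (n + 1) f = (⟨diff X V n f, A.diff_mem n f f.2⟩ : A.carrier (n + 1)) := by
  simp only [complex, CochainComplex.of_d]
  rfl

theorem inclusion_f_apply {A B : Subcomplex X V} (h : ∀ n, A.carrier n ≤ B.carrier n) (n : ℕ)
    (f : A.carrier n) : (inclusion h).f n f = (⟨f, h n f.2⟩ : B.carrier n) := rfl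

/-- `f` is a coboundary of degree `n` in the complex `A`. -/
def IsCoboundary (A : Subcomplex X V) : ∀ {n : ℕ}, Cochain X V n → Prop
  | 0, f => f = 0
  | n + 1, f => ∃ g ∈ A.carrier n, diff X V n g = f

theorem isCoboundary_iff (A : Subcomplex X V) {n : ℕ} (f : A.carrier n) :
    A.IsCoboundary f.1 ↔
      ∃ g : A.complex.X ((ComplexShape.up ℕ).prev n),
        A.complex.d ((ComplexShape.up ℕ).prev n) n g = f := by
  cases n with
  | zero =>
    have h0 : A.complex.d ((ComplexShape.up ℕ).prev 0) 0 = 0 := A.complex.shape _ _ (by simp)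
    rw [h0]
    constructor
    · intro h
      exact ⟨0, Subtype.ext h.symm⟩
    · rintro ⟨g, hg⟩
      exact (congrArg Subtype.val hg).symm
  | succ n =>
    rw [CochainComplex.prev_nat_succ]
    constructor
    · rintro ⟨g, hg, h⟩
      exact ⟨(⟨g, hg⟩ : A.carrier n), by rw [complex_d_apply]; exact Subtype.ext h⟩
    · rintro ⟨g, h⟩
      exact ⟨Subtype.val (p := (· ∈ A.carrier n)) g, Subtype.property (p := (· ∈ A.carrier n)) g,
        congrArg Subtype.val ((complex_d_apply A n g).symm.trans h)⟩

/-- The homomorphism on the free abelian group on the elements of `A` given by a map on `A`. -/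
noncomputable def freeDesc {A M : AddCommGrpCat.{u}} (φ : A → M) :
    AddCommGrpCat.of (FreeAbelianGroup A) ⟶ M :=
  AddCommGrpCat.ofHom (FreeAbelianGroup.lift φ)

theorem freeDesc_of {A M : AddCommGrpCat.{u}} (φ : A → M) (a : A) :
    freeDesc φ (FreeAbelianGroup.of a) = φ a :=
  FreeAbelianGroup.lift_apply_of _ _

/-- The epimorphism onto an abelian group from the free abelian group on its elements. -/
noncomputable def freeCover (A : AddCommGrpCat.{u}) :
    AddCommGrpCat.of (FreeAbelianGroup A) ⟶ A :=
  freeDesc id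

instance (A : AddCommGrpCat.{u}) : Epi (freeCover A) := by
  rw [AddCommGrpCat.epi_iff_surjective]
  exact fun a => ⟨FreeAbelianGroup.of a, freeDesc_of _ _⟩

theorem freeCover_hom_ext {A B : AddCommGrpCat.{u}}
    {f g : AddCommGrpCat.of (FreeAbelianGroup A) ⟶ B}
    (h : ∀ a : A, f (FreeAbelianGroup.of a) = g (FreeAbelianGroup.of a)) : f = g :=
  AddCommGrpCat.hom_ext (FreeAbelianGroup.lift_ext _ _ h)

/-- Mono and epi on homology are tested on generalised elements up to an epimorphic refinement.
Elementwise choices need not be additive, but they extend to homomorphisms on the free abelian group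
on the test object, which serves as the refinement. -/
theorem isIso_homologyMap_inclusion {A B : Subcomplex X V} (h : ∀ n, A.carrier n ≤ B.carrier n)
    (n : ℕ)
    (surj : ∀ f ∈ B.carrier n, diff X V n f = 0 →
      ∃ F ∈ A.carrier n, diff X V n F = 0 ∧ B.IsCoboundary (f - F))
    (inj : ∀ F ∈ A.carrier n, B.IsCoboundary F → A.IsCoboundary F) :
    IsIso (HomologicalComplex.homologyMap (inclusion h) n) := by
  have hnext : (ComplexShape.up ℕ).next n = n + 1 := CochainComplex.next ℕ n
  have hmono : Mono (HomologicalComplex.homologyMap (inclusion h) n) := by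
    rw [HomologicalComplex.mono_homologyMap_iff_up_to_refinements _ _ n (n + 1) rfl hnext]
    intro T x hx y hxy
    have key : ∀ t : T, ∃ g : A.complex.X ((ComplexShape.up ℕ).prev n),
        A.complex.d ((ComplexShape.up ℕ).prev n) n g = x t := by
      intro t
      refine (A.isCoboundary_iff (x t : A.carrier n)).1 (inj _ (Subtype.property _) ?_)
      have := (B.isCoboundary_iff ((inclusion h).f n (x t) : B.carrier n)).2
        ⟨y t, (ConcreteCategory.congr_hom hxy t).symm⟩
      exact this
    choose g hg using key
    refine ⟨_, freeCover T, inferInstance, freeDesc g,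
      freeCover_hom_ext fun t => ?_⟩
    have h1 : freeCover T (FreeAbelianGroup.of t) = t := freeDesc_of _ _
    rw [ConcreteCategory.comp_apply, ConcreteCategory.comp_apply, h1, freeDesc_of, hg]
  have hepi : Epi (HomologicalComplex.homologyMap (inclusion h) n) := by
    rw [HomologicalComplex.epi_homologyMap_iff_up_to_refinements _ _ n (n + 1) rfl hnext]
    intro T y hy
    have key : ∀ t : T, ∃ F : A.complex.X n, A.complex.d n (n + 1) F = 0 ∧
        ∃ g : B.complex.X ((ComplexShape.up ℕ).prev n),
          y t = (inclusion h).f n F + B.complex.d ((ComplexShape.up ℕ).prev n) n g := by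
      intro t
      have hyt : B.complex.d n (n + 1) (y t) = 0 := ConcreteCategory.congr_hom hy t
      obtain ⟨z, hz⟩ : ∃ z : B.carrier n, z = y t := ⟨y t, rfl⟩
      rw [← hz] at hyt ⊢
      obtain ⟨F, hF, hdF, hb⟩ := surj z.1 z.2
        (congrArg Subtype.val ((complex_d_apply B n z).symm.trans hyt))
      obtain ⟨g, hg⟩ := (B.isCoboundary_iff (z - ⟨F, h n hF⟩)).1 hb
      refine ⟨(⟨F, hF⟩ : A.carrier n), ?_, g, ?_⟩
      · rw [complex_d_apply]
        exact Subtype.ext hdF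
      · rw [inclusion_f_apply, hg]
        exact (add_sub_cancel (⟨F, h n hF⟩ : B.carrier n) z).symm
    choose F hF g hg using key
    refine ⟨_, freeCover T, inferInstance, freeDesc F,
      freeCover_hom_ext fun t => ?_, freeDesc g,
      freeCover_hom_ext fun t => ?_⟩
    · rw [ConcreteCategory.comp_apply, freeDesc_of, hF]
      rfl
    · have h1 : freeCover T (FreeAbelianGroup.of t) = t := freeDesc_of _ _
      rw [ConcreteCategory.comp_apply, h1, hg]
      change _ = (inclusion h).f n (freeDesc F (FreeAbelianGroup.of t)) +
        B.complex.d _ n (freeDesc g (FreeAbelianGroup.of t))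
      rw [freeDesc_of, freeDesc_of]
  exact isIso_of_mono_of_epi _

end Subcomplex

/-! ### Double complexes with exact columns -/

section DoubleComplex

variable {A : ℕ → ℕ → Type*} [∀ p q, AddCommGroup (A p q)]

/-- The horizontal part of the total differential. -/
def horizontal (h : ∀ p q, A p q →+ A (p + 1) q) (k : ∀ p q, A p q) : ∀ p q, A p q
  | 0, _ => 0
  | p + 1, q => h p q (k p q)

/-- The vertical part of the total differential. -/
def vertical (v : ∀ p q, A p q →+ A p (q + 1)) (k : ∀ p q, A p q) : ∀ p q, A p q
  | _, 0 => 0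
  | p, q + 1 => v p q (k p q)

/-- If the columns of a double complex are exact in positive degrees, then every family whose
total differential is concentrated on the bottom row is cohomologous to a family concentrated on
the bottom row and consisting of vertical cocycles. -/
theorem exists_eq_total_differential {h : ∀ p q, A p q →+ A (p + 1) q}
    {v : ∀ p q, A p q →+ A p (q + 1)}
    (hh : ∀ p q a, h (p + 1) q (h p q a) = 0)
    (hv : ∀ p q a, h p (q + 1) (v p q a) + v (p + 1) q (h p q a) = 0)
    (exact : ∀ p q a, v p (q + 1) a = 0 → ∃ b, v p q b = a)
    (g : ∀ p q, A p q) (hg : ∀ p q, horizontal h g p (q + 1) + vertical v g p (q + 1) = 0) :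
    ∃ k : ∀ p q, A p q,
      (∀ p q, g p (q + 1) = horizontal h k p (q + 1) + vertical v k p (q + 1)) ∧
      ∀ p, v p 0 (g p 0 - horizontal h k p 0) = 0 := by
  have hv' : ∀ p q a, v (p + 1) q (h p q a) = - h p (q + 1) (v p q a) := fun p q a =>
    eq_neg_of_add_eq_zero_right (hv p q a)
  have h0 : ∀ q, v 0 q (g 0 q) = 0 := fun q => by simpa [horizontal, vertical] using hg 0 q
  have hs : ∀ p q, h p (q + 1) (g p (q + 1)) + v (p + 1) q (g (p + 1) q) = 0 := fun p q => by
    simpa [horizontal, vertical] using hg (p + 1) q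
  -- The invariant for solving column by column: once `k` is chosen in column `p`, what remains of
  -- `g` in column `p + 1` is a vertical cocycle, to which exactness applies again.
  let E : ∀ p, (∀ q, A p q) → Prop := fun p k =>
    ∀ q, v (p + 1) q (g (p + 1) q - h p q (k q)) = 0
  have start : ∃ k : {k : ∀ q, A 0 q // E 0 k}, ∀ q, g 0 (q + 1) = v 0 q (k.1 q) := by
    choose k hk using fun q => exact 0 q _ (h0 (q + 1))
    refine ⟨⟨k, fun q => ?_⟩, fun q => (hk q).symm⟩
    rw [map_sub, hv', hk, sub_neg_eq_add]
    exact (add_comm _ _).trans (hs _ _)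
  have step : ∀ p (k : {k : ∀ q, A p q // E p k}), ∃ k' : {k : ∀ q, A (p + 1) q // E (p + 1) k},
      ∀ q, g (p + 1) (q + 1) = h p (q + 1) (k.1 (q + 1)) + v (p + 1) q (k'.1 q) := by
    intro p k
    choose k' hk' using fun q => exact (p + 1) q _ (k.2 (q + 1))
    refine ⟨⟨k', fun q => ?_⟩, fun q => ?_⟩
    · rw [map_sub, hv', hk', map_sub, hh, sub_zero, sub_neg_eq_add]
      exact (add_comm _ _).trans (hs _ _)
    · rw [hk', add_sub_cancel]
  obtain ⟨k₀, hk₀⟩ := start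
  choose next hnext using step
  let K : ∀ p, {k : ∀ q, A p q // E p k} := fun p => Nat.rec k₀ next p
  refine ⟨fun p => (K p).1, fun p q => ?_, fun p => ?_⟩
  · cases p with
    | zero => exact (hk₀ q).trans (zero_add _).symm
    | succ p => exact hnext p (K p) q
  · cases p with
    | zero => simpa [horizontal] using h0 0
    | succ p => exact (K p).2 0

end DoubleComplex

/-! ### Cochains evaluated on sequences -/

section Sequences

variable {X V : Type u} [AddCommGroup V]

/-- The increasing map `ℕ → ℕ` whose image misses exactly `i`. -/
def skip (i m : ℕ) : ℕ := if m < i then m else m + 1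

theorem val_succAbove {n : ℕ} (i : Fin (n + 1)) (j : Fin n) :
    (i.succAbove j : ℕ) = skip i j := by
  simp only [Fin.succAbove, Fin.lt_def, skip, Fin.val_castSucc]
  split_ifs <;> simp

/-- A tuple as a sequence. -/
def seq {n : ℕ} (x : Fin (n + 1) → X) (m : ℕ) : X := x (Fin.ofNat (n + 1) m)

theorem seq_val {n : ℕ} (x : Fin (n + 1) → X) (i : Fin (n + 1)) : seq x i = x i := by
  simp [seq]

theorem seq_restrict {n m : ℕ} (w : ℕ → X) (hm : m ≤ n) :
    seq (fun i : Fin (n + 1) => w i) m = w m := by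
  simp [seq, Nat.mod_eq_of_lt (Nat.lt_succ_of_le hm)]

theorem exists_sequence {n : ℕ} (x : Fin (n + 1) → X) :
    ∃ w : ℕ → X, x = fun i : Fin (n + 1) => w i :=
  ⟨seq x, funext fun i => (seq_val x i).symm⟩

theorem diff_restrict {n : ℕ} (f : Cochain X V n) (w : ℕ → X) :
    diff X V n f (fun i => w i) =
      ∑ i ∈ Finset.range (n + 2), (-1 : ℤ) ^ i • f fun j => w (skip i j) := by
  rw [diff_apply, Finset.sum_range]
  refine Finset.sum_congr rfl fun i _ => ?_
  congr 2
  funext j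
  simp [val_succAbove]

/-! ### The prism operator -/

/-- The vertices of the `j`-th simplex of the prism between `s ∘ w` and `t ∘ w`. -/
def prismVertex (s t : X → X) (j : ℕ) (w : ℕ → X) (m : ℕ) : X :=
  if m ≤ j then s (w m) else t (w (m - 1))

/-- The prism operator of two maps `s` and `t`. -/
def prism (s t : X → X) {n : ℕ} (f : Cochain X V (n + 1)) : Cochain X V n := fun x =>
  ∑ j ∈ Finset.range (n + 1), (-1 : ℤ) ^ j • f fun m => prismVertex s t j (seq x) m

theorem prism_restrict (s t : X → X) {n : ℕ} (f : Cochain X V (n + 1)) (w : ℕ → X) :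
    prism s t f (fun i => w i) =
      ∑ j ∈ Finset.range (n + 1), (-1 : ℤ) ^ j • f fun m => prismVertex s t j w m := by
  refine Finset.sum_congr rfl fun j hj => ?_
  rw [Finset.mem_range] at hj
  congr 2
  funext m
  have := m.2
  simp only [prismVertex]
  split_ifs
  · rw [seq_restrict _ (by omega)]
  · rw [seq_restrict _ (by omega)]

/-- The sign bookkeeping of the prism formula, with `a i j` standing for the value on the `i`-th
face of the `j`-th simplex: all faces cancel except the two at each break between bottom and top. -/
theorem sum_prism (a : ℕ → ℕ → V) (n : ℕ) :
    ∑ i ∈ Finset.range (n + 1), (-1 : ℤ) ^ i • ∑ j ∈ Finset.range n,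
        (-1 : ℤ) ^ j • (if i ≤ j then a i (j + 1) else a (i + 1) j) +
      ∑ j ∈ Finset.range (n + 1), (-1 : ℤ) ^ j • ∑ i ∈ Finset.range (n + 2), (-1 : ℤ) ^ i • a i j
      = ∑ j ∈ Finset.range (n + 1), (a j j - a (j + 1) j) := by
  induction n with
  | zero => simp [Finset.sum_range_succ, sub_eq_add_neg]
  | succ n ih =>
    rw [Finset.sum_range_succ (fun j => a j j - a (j + 1) j) (n + 1), ← ih]
    have e1 : ∀ i ∈ Finset.range (n + 1), (-1 : ℤ) ^ i • ∑ j ∈ Finset.range (n + 1),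
        (-1 : ℤ) ^ j • (if i ≤ j then a i (j + 1) else a (i + 1) j) =
        (-1 : ℤ) ^ i • ∑ j ∈ Finset.range n,
          (-1 : ℤ) ^ j • (if i ≤ j then a i (j + 1) else a (i + 1) j)
        + (-1 : ℤ) ^ (i + n) • a i (n + 1) := by
      intro i hi
      rw [Finset.mem_range] at hi
      rw [Finset.sum_range_succ, smul_add, if_pos (by omega), smul_smul, pow_add]
    have e2 : ∀ j ∈ Finset.range (n + 1), (-1 : ℤ) ^ (n + 1) • (-1 : ℤ) ^ j •
        (if n + 1 ≤ j then a (n + 1) (j + 1) else a (n + 1 + 1) j) =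
        (-1 : ℤ) ^ (n + 1 + j) • a (n + 2) j := by
      intro j hj
      rw [Finset.mem_range] at hj
      rw [if_neg (by omega), smul_smul, pow_add _ (n + 1) j]
    have e3 : ∀ j, (-1 : ℤ) ^ j • ∑ i ∈ Finset.range (n + 1 + 2), (-1 : ℤ) ^ i • a i j =
        (-1 : ℤ) ^ j • ∑ i ∈ Finset.range (n + 2), (-1 : ℤ) ^ i • a i j
        - (-1 : ℤ) ^ (n + 1 + j) • a (n + 2) j := by
      intro j
      rw [Finset.sum_range_succ _ (n + 2), smul_add, smul_smul, sub_eq_add_neg, ← neg_smul]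
      congr 2
      ring
    rw [Finset.sum_range_succ (fun i => (-1 : ℤ) ^ i • ∑ j ∈ Finset.range (n + 1),
        (-1 : ℤ) ^ j • (if i ≤ j then a i (j + 1) else a (i + 1) j)) (n + 1),
      Finset.sum_congr rfl e1, Finset.smul_sum,
      Finset.sum_congr rfl e2, Finset.sum_add_distrib, Finset.sum_congr rfl fun j _ => e3 j,
      Finset.sum_sub_distrib, Finset.sum_range_succ _ (n + 1)]
    rw [Finset.sum_range_succ (fun j => (-1 : ℤ) ^ (n + 1 + j) • a (n + 2) j) (n + 1),
      Finset.sum_range_succ (fun i => (-1 : ℤ) ^ i • a i (n + 1)) (n + 1), smul_add,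
      Finset.smul_sum]
    have e4 : ∀ i, (-1 : ℤ) ^ (n + 1) • (-1 : ℤ) ^ i • a i (n + 1) =
        - ((-1 : ℤ) ^ (i + n) • a i (n + 1)) := by
      intro i
      rw [smul_smul, ← neg_smul]
      congr 1
      ring
    have e5 : ((-1 : ℤ) ^ (n + 1) * (-1 : ℤ) ^ (n + 1)) = 1 := by
      rw [← mul_pow]; simp
    rw [Finset.sum_congr rfl fun i _ => e4 i, Finset.sum_neg_distrib, smul_smul, e5,
      pow_add _ (n + 1) (n + 1), e5, one_smul, one_smul]
    abel

/-- Consecutive simplices of the prism share an inner face, so the surviving terms of `sum_prism`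
telescope to the top and the bottom. -/
theorem diff_prism (s t : X → X) {n : ℕ} (f : Cochain X V (n + 1)) (x : Fin (n + 2) → X) :
    diff X V n (prism s t f) x + prism s t (diff X V (n + 1) f) x =
      f (t ∘ x) - f (s ∘ x) := by
  obtain ⟨w, rfl⟩ := exists_sequence x
  let a : ℕ → ℕ → V := fun i j => f fun m => prismVertex s t j w (skip i m)
  have h1 : diff X V n (prism s t f) (fun i => w i) = ∑ i ∈ Finset.range (n + 1 + 1),
      (-1 : ℤ) ^ i • ∑ j ∈ Finset.range (n + 1),
        (-1 : ℤ) ^ j • (if i ≤ j then a i (j + 1) else a (i + 1) j) := by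
    rw [diff_restrict]
    refine Finset.sum_congr rfl fun i _ => ?_
    rw [prism_restrict s t f (fun j => w (skip i j))]
    congr 1
    refine Finset.sum_congr rfl fun j _ => ?_
    congr 1
    split_ifs with hij
    all_goals
      refine congrArg f (funext fun m => ?_)
      simp only [prismVertex, skip]
      split_ifs <;> first | rfl | omega | skip
    all_goals
      congr 2
      omega
  have h2 : prism s t (diff X V (n + 1) f) (fun i => w i) = ∑ j ∈ Finset.range (n + 1 + 1),
      (-1 : ℤ) ^ j • ∑ i ∈ Finset.range (n + 1 + 2), (-1 : ℤ) ^ i • a i j := by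
    rw [prism_restrict]
    refine Finset.sum_congr rfl fun j _ => ?_
    rw [diff_restrict]
  have h3 : ∀ j, a (j + 1) j = a (j + 1) (j + 1) := by
    intro j
    refine congrArg f (funext fun m => ?_)
    simp only [prismVertex, skip]
    split_ifs <;> first | rfl | omega
  rw [h1, h2, sum_prism, Finset.sum_congr rfl fun j _ => by rw [h3 j],
    Finset.sum_range_sub' (fun j => a j j)]
  congr 1
  refine congrArg f (funext fun m => ?_)
  have hm : skip (n + 2) m = m := if_pos m.2
  simp only [prismVertex, hm]
  exact if_pos (by omega)

end Sequences

/-! ### The standard double complex -/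

/-- Functions of bidegree `(p, q)`. -/
abbrev BiCochain (X V : Type u) (p q : ℕ) : Type u :=
  (Fin (p + 1) → X) × (Fin (q + 1) → X) → V

section BiCochain

variable {X V : Type u} [AddCommGroup V]

/-- The differential in the first group of variables. -/
def diffL (p q : ℕ) : BiCochain X V p q →+ BiCochain X V (p + 1) q where
  toFun f z := diff X V p (fun x => f (x, z.2)) z.1
  map_zero' := funext fun z => congrFun (map_zero (diff X V p)) z.1
  map_add' f g := funext fun z =>
    congrFun (map_add (diff X V p) (fun x => f (x, z.2)) fun x => g (x, z.2)) z.1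

/-- The differential in the second group of variables, with the sign making it anticommute with
the differential in the first group of variables. -/
def diffR (p q : ℕ) : BiCochain X V p q →+ BiCochain X V p (q + 1) where
  toFun f z := (-1 : ℤ) ^ p • diff X V q (fun y => f (z.1, y)) z.2
  map_zero' := funext fun z => by
    have := congrFun (map_zero (diff X V q)) z.2
    simp only [Pi.zero_apply] at this ⊢
    rw [← smul_zero ((-1 : ℤ) ^ p), ← this]
    rfl
  map_add' f g := funext fun z => by
    rw [Pi.add_apply, ← smul_add]
    exact congrArg _
      (congrFun (map_add (diff X V q) (fun y => f (z.1, y)) fun y => g (z.1, y)) z.2)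

theorem diffL_apply {p q : ℕ} (f : BiCochain X V p q)
    (z : (Fin (p + 2) → X) × (Fin (q + 1) → X)) :
    diffL p q f z = diff X V p (fun x => f (x, z.2)) z.1 := rfl

theorem diffR_apply {p q : ℕ} (f : BiCochain X V p q)
    (z : (Fin (p + 1) → X) × (Fin (q + 2) → X)) :
    diffR p q f z = (-1 : ℤ) ^ p • diff X V q (fun y => f (z.1, y)) z.2 := rfl

theorem diffR_eq_zero_iff {p q : ℕ} (f : BiCochain X V p q) :
    diffR p q f = 0 ↔ ∀ x, diff X V q (fun y => f (x, y)) = 0 := by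
  constructor
  · intro h x
    funext y
    have := congrFun h (x, y)
    rw [diffR_apply] at this
    have h2 : (-1 : ℤ) ^ p * (-1 : ℤ) ^ p = 1 := by rw [← mul_pow]; simp
    rw [← one_smul ℤ (diff X V q (fun y => f (x, y)) y), ← h2, mul_smul, this]
    simp
  · intro h
    funext z
    rw [diffR_apply, h z.1]
    simp

theorem diffL_diffL {p q : ℕ} (f : BiCochain X V p q) : diffL (p + 1) q (diffL p q f) = 0 :=
  funext fun z => congrFun (diff_diff fun x => f (x, z.2)) z.1

theorem diffR_diffR {p q : ℕ} (f : BiCochain X V p q) : diffR p (q + 1) (diffR p q f) = 0 := by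
  rw [diffR_eq_zero_iff]
  intro x
  have h : (fun y => diffR p q f (x, y)) = (-1 : ℤ) ^ p • diff X V q fun y => f (x, y) := rfl
  rw [h, map_zsmul, diff_diff, smul_zero]

theorem diffL_diffR {p q : ℕ} (f : BiCochain X V p q) :
    diffL p (q + 1) (diffR p q f) + diffR (p + 1) q (diffL p q f) = 0 := by
  funext z
  simp only [Pi.add_apply, Pi.zero_apply, diffL_apply, diffR_apply, diff_apply, Finset.smul_sum,
    smul_smul]
  rw [Finset.sum_comm, ← Finset.sum_add_distrib]
  refine Finset.sum_eq_zero fun i _ => ?_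
  rw [← Finset.sum_add_distrib]
  refine Finset.sum_eq_zero fun j _ => ?_
  rw [← add_smul]
  convert zero_smul ℤ _
  ring

/-- The Alexander–Whitney map from the double complex to the standard complex. -/
def alexanderWhitney (k : ∀ p q, BiCochain X V p q) (n : ℕ) : Cochain X V n := fun x =>
  ∑ a ∈ Finset.HasAntidiagonal.antidiagonal n,
    k a.1 a.2 (fun i => seq x i, fun j => seq x (a.1 + j))

theorem alexanderWhitney_restrict (k : ∀ p q, BiCochain X V p q) (n : ℕ) (w : ℕ → X) :
    alexanderWhitney k n (fun i => w i) =
      ∑ a ∈ Finset.HasAntidiagonal.antidiagonal n,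
        k a.1 a.2 (fun i => w i, fun j => w (a.1 + j)) := by
  refine Finset.sum_congr rfl fun a ha => ?_
  rw [Finset.HasAntidiagonal.mem_antidiagonal] at ha
  congr 2
  · funext i
    have := i.2
    exact seq_restrict w (by omega)
  · funext j
    have := j.2
    exact seq_restrict w (by omega)

theorem alexanderWhitney_add (k l : ∀ p q, BiCochain X V p q) (n : ℕ) :
    alexanderWhitney (fun p q => k p q + l p q) n =
      alexanderWhitney k n + alexanderWhitney l n := by
  funext x
  simp [alexanderWhitney, Finset.sum_add_distrib]

theorem alexanderWhitney_left (F : ∀ p, Cochain X V p) (k : ∀ p q, BiCochain X V p q)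
    (h0 : ∀ p x y, k p 0 (x, y) = F p x) (hs : ∀ p q, k p (q + 1) = 0) (n : ℕ) :
    alexanderWhitney k n = F n := by
  funext x
  obtain ⟨w, rfl⟩ := exists_sequence x
  rw [alexanderWhitney_restrict, Finset.sum_eq_single (n, 0)]
  · exact h0 _ _ _
  · rintro ⟨a, b⟩ hab hne
    rw [Finset.HasAntidiagonal.mem_antidiagonal] at hab
    cases b with
    | zero => exact absurd (congrArg (·, 0) hab) hne
    | succ b => exact congrFun (hs _ _) _
  · simp

theorem alexanderWhitney_right (f : ∀ q, Cochain X V q) (k : ∀ p q, BiCochain X V p q)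
    (h0 : ∀ q x y, k 0 q (x, y) = f q y) (hs : ∀ p q, k (p + 1) q = 0) (n : ℕ) :
    alexanderWhitney k n = f n := by
  funext x
  obtain ⟨w, rfl⟩ := exists_sequence x
  rw [alexanderWhitney_restrict, Finset.sum_eq_single (0, n)]
  · simp only [h0, Nat.zero_add]
  · rintro ⟨a, b⟩ hab hne
    rw [Finset.HasAntidiagonal.mem_antidiagonal] at hab
    cases a with
    | zero => exact absurd (congrArg (0, ·) ((Nat.zero_add b).symm.trans hab)) hne
    | succ a => exact congrFun (hs _ _) _
  · simp

/-- The Leibniz rule of a cup product: for each `(a, b)`, the last face of the front block and the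
first face of the back block coincide with opposite signs, and the remaining faces are exactly those
of `diff`. -/
theorem alexanderWhitney_total_succ (k : ∀ p q, BiCochain X V p q) (n : ℕ) :
    alexanderWhitney (fun p q => horizontal diffL k p q + vertical diffR k p q) (n + 1) =
      diff X V n (alexanderWhitney k n) := by
  funext x
  obtain ⟨w, rfl⟩ := exists_sequence x
  rw [diff_restrict, alexanderWhitney_restrict]
  simp only [Pi.add_apply, Finset.sum_add_distrib]
  rw [Finset.Nat.sum_antidiagonal_succ, Finset.Nat.sum_antidiagonal_succ'
    (f := fun a => vertical diffR k a.1 a.2 (fun i => w i, fun j => w (a.1 + j)))]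
  have hR : ∀ i ∈ Finset.range (n + 2), (-1 : ℤ) ^ i • alexanderWhitney k n
      (fun j => w (skip i j)) = ∑ a ∈ Finset.HasAntidiagonal.antidiagonal n, (-1 : ℤ) ^ i •
        k a.1 a.2 (fun m => w (skip i m), fun m => w (skip i (a.1 + m))) := by
    intro i _
    rw [alexanderWhitney_restrict k n (fun j => w (skip i j)), Finset.smul_sum]
  rw [Finset.sum_congr rfl hR, Finset.sum_comm]
  simp only [horizontal, vertical, Pi.zero_apply, zero_add]
  rw [← Finset.sum_add_distrib]
  refine Finset.sum_congr rfl ?_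
  rintro ⟨a, b⟩ hab
  rw [Finset.HasAntidiagonal.mem_antidiagonal] at hab
  dsimp only at hab ⊢
  subst hab
  rw [diffL_apply, diffR_apply]
  dsimp only
  rw [diff_restrict (fun x => k a b (x, fun j => w (a + 1 + j))) w,
    diff_restrict (fun y => k a b (fun i => w i, y)) (fun j => w (a + j)),
    show a + b + 2 = (a + 1) + (b + 1) by ring,
    Finset.sum_range_add _ (a + 1) (b + 1),
    Finset.sum_range_succ _ (a + 1), Finset.sum_range_succ' _ (b + 1), smul_add]
  have e1 : (fun j : Fin (a + 1) => w (skip (a + 1) j)) = fun j : Fin (a + 1) => w j :=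
    funext fun j => congrArg w (if_pos j.2)
  have e2 : (fun j : Fin (b + 1) => w (a + skip 0 j)) =
      fun j : Fin (b + 1) => w (a + 1 + j) :=
    funext fun j => congrArg w (by simp [skip]; ring)
  rw [e1, e2, pow_zero, one_smul, pow_succ (-1 : ℤ) a, mul_neg_one, neg_smul]
  have e3 : ∀ i ∈ Finset.range (a + 1), (-1 : ℤ) ^ i •
      k a b (fun j => w (skip i j), fun j => w (a + 1 + j)) = (-1 : ℤ) ^ i •
      k a b (fun m => w (skip i m), fun m => w (skip i (a + m))) := by
    intro i hi
    rw [Finset.mem_range] at hi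
    congr 3
    refine funext fun j => congrArg w ?_
    rw [skip, if_neg (by omega)]
    ring
  have e4 : ∀ i ∈ Finset.range (b + 1), (-1 : ℤ) ^ a • (-1 : ℤ) ^ (i + 1) •
      k a b (fun j => w j, fun j => w (a + skip (i + 1) j)) = (-1 : ℤ) ^ (a + 1 + i) •
      k a b (fun m => w (skip (a + 1 + i) m), fun m => w (skip (a + 1 + i) (a + m))) := by
    intro i hi
    rw [smul_smul, ← pow_add, show a + (i + 1) = a + 1 + i by ring]
    congr 3
    · refine funext fun j => congrArg w ?_
      have := j.2
      rw [skip, if_pos (by omega)]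
    · refine funext fun j => congrArg w ?_
      simp only [skip]
      split_ifs <;> omega
  rw [Finset.sum_congr rfl e3, Finset.smul_sum, Finset.sum_congr rfl e4]
  abel

theorem alexanderWhitney_total_zero (k : ∀ p q, BiCochain X V p q) :
    alexanderWhitney (fun p q => horizontal diffL k p q + vertical diffR k p q) 0 = 0 := by
  funext x
  simp [alexanderWhitney, horizontal, vertical]

end BiCochain

/-- The cone formula behind the exactness of the rows. -/
theorem diff_cons {X V : Type u} [AddCommGroup V] {n : ℕ} (f : Cochain X V (n + 1)) (a : X)
    (x : Fin (n + 2) → X) : diff X V (n + 1) f (Fin.cons a x : Fin (n + 3) → X) =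
      f x - diff X V n (fun y => f (Fin.cons a y : Fin (n + 2) → X)) x := by
  rw [diff_apply, diff_apply, Fin.sum_univ_succ, sub_eq_add_neg, ← Finset.sum_neg_distrib]
  congr 1
  · simp only [Fin.val_zero, pow_zero, one_smul]
    exact congrArg f (funext fun j => by simp)
  · refine Finset.sum_congr rfl fun i _ => ?_
    rw [Fin.val_succ, pow_succ, mul_neg_one, neg_smul]
    congr 3
    funext j
    refine Fin.cases ?_ (fun j => ?_) j
    · simp
    · simp

/-! ### Local continuity on `k`-ifications -/

section Near

variable {Y Z V : Type u} [TopologicalSpace Y] [TopologicalSpace Z] [TopologicalSpace V]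

theorem kContinuousOn_iff {f : Y → V} {s : Set Y} :
    KContinuousOn f s ↔
      ∀ (S : CompHaus.{u}) (g : C(S, Y)), (∀ x, g x ∈ s) → Continuous (f ∘ g) := by
  rw [KContinuousOn, kContinuous_iff]
  constructor
  · intro h S g hg
    exact h S ⟨fun x => ⟨g x, hg x⟩, g.continuous.subtype_mk _⟩
  · intro h S g
    exact h S ⟨fun x => (g x).1, continuous_subtype_val.comp g.continuous⟩ fun x => (g x).2

/-- `f` is continuous on the `k`-ification of some neighbourhood of `z`. -/
def KContinuousNear (f : Y → V) (z : Y) : Prop :=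
  ∃ W, IsOpen W ∧ z ∈ W ∧ KContinuousOn f W

theorem KContinuousOn.near {f : Y → V} {s : Set Y} (hf : KContinuousOn f s) (hs : IsOpen s) {z : Y}
    (hz : z ∈ s) : KContinuousNear f z := ⟨s, hs, hz, hf⟩

theorem KContinuous.near {f : Y → V} (hf : KContinuous f) (z : Y) : KContinuousNear f z :=
  ⟨Set.univ, isOpen_univ, trivial, hf.comp_continuous continuous_subtype_val⟩

theorem isOpen_setOf_kContinuousNear (f : Y → V) : IsOpen {z | KContinuousNear f z} := by
  refine isOpen_iff_forall_mem_open.2 ?_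
  rintro z ⟨W, hW, hz, hf⟩
  exact ⟨W, fun z' hz' => ⟨W, hW, hz', hf⟩, hW, hz⟩

theorem exists_mem_nhds_isCompact_subset_of_compact {S : Type*} [TopologicalSpace S]
    [CompactSpace S] [T2Space S] {x : S} {W : Set S} (hW : W ∈ 𝓝 x) :
    ∃ K ∈ 𝓝 x, K ⊆ W ∧ IsCompact K :=
  local_compact_nhds hW

/-- Each point of a compact Hausdorff test space has a compact neighbourhood mapped into a good open
set, and this neighbourhood is again a test space. Hence continuity on `k`-ifications can be checked
locally. -/
theorem kContinuousOn_of_near {f : Y → V} {s : Set Y} (hf : ∀ z ∈ s, KContinuousNear f z) :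
    KContinuousOn f s := by
  rw [kContinuousOn_iff]
  intro S g hg
  rw [continuous_iff_continuousAt]
  intro x
  obtain ⟨W, hW, hx, h⟩ := hf _ (hg x)
  obtain ⟨K, hK, hKW, hKc⟩ :=
    exists_mem_nhds_isCompact_subset_of_compact ((hW.preimage g.continuous).mem_nhds hx)
  have : CompactSpace K := isCompact_iff_compactSpace.1 hKc
  have h1 := kContinuousOn_iff.1 h (CompHaus.of K)
    ⟨fun k => g k.1, g.continuous.comp continuous_subtype_val⟩ fun k => hKW k.2
  have h2 : ContinuousOn (f ∘ g) K := continuousOn_iff_continuous_domRestrict.2 h1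
  exact h2.continuousAt hK

theorem kContinuous_of_near {f : Y → V} (hf : ∀ z, KContinuousNear f z) : KContinuous f :=
  (kContinuous_iff f).2 fun S g =>
    kContinuousOn_iff.1 (kContinuousOn_of_near fun z (_ : z ∈ Set.univ) => hf z) S g
      fun _ => trivial

theorem KContinuousNear.comp {f : Z → V} {φ : Y → Z} {z : Y} (hf : KContinuousNear f (φ z))
    (hφ : Continuous φ) : KContinuousNear (fun y => f (φ y)) z := by
  obtain ⟨W, hW, hz, h⟩ := hf
  exact ⟨φ ⁻¹' W, hW.preimage hφ, hz, h.comp_mapsTo hφ fun _ hy => hy⟩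

theorem KContinuousNear.congr {f g : Y → V} {z : Y} (hf : KContinuousNear f z)
    (h : ∀ᶠ y in 𝓝 z, f y = g y) : KContinuousNear g z := by
  obtain ⟨W, hW, hz, hfW⟩ := hf
  obtain ⟨U, hU, hUo, hzU⟩ := eventually_nhds_iff.1 h
  refine ⟨W ∩ U, hW.inter hUo, ⟨hz, hzU⟩, ?_⟩
  have h1 := hfW.mono (Set.inter_subset_left (t := U))
  have h2 : (fun y : (W ∩ U : Set Y) => f y) = fun y : (W ∩ U : Set Y) => g y :=
    funext fun y => hU _ y.2.2
  rw [KContinuousOn, ← h2]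
  exact h1

theorem KContinuousNear.zero [Zero V] (z : Y) : KContinuousNear (fun _ => (0 : V)) z :=
  (KContinuous.of_continuous continuous_const).near z

variable [AddCommGroup V] [IsKAddGroup V]

theorem KContinuousNear.add {f g : Y → V} {z : Y} (hf : KContinuousNear f z)
    (hg : KContinuousNear g z) : KContinuousNear (fun y => f y + g y) z := by
  obtain ⟨W, hW, hz, hfW⟩ := hf
  obtain ⟨U, hU, hzU, hgU⟩ := hg
  exact ⟨W ∩ U, hW.inter hU, ⟨hz, hzU⟩, KContinuous.add (hfW.mono Set.inter_subset_left)
    (hgU.mono Set.inter_subset_right)⟩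

theorem KContinuousNear.neg {f : Y → V} {z : Y} (hf : KContinuousNear f z) :
    KContinuousNear (fun y => - f y) z := by
  obtain ⟨W, hW, hz, hfW⟩ := hf
  exact ⟨W, hW, hz, KContinuous.neg hfW⟩

theorem KContinuousNear.sum {ι : Type*} {s : Finset ι} {f : ι → Y → V} {z : Y}
    (hf : ∀ i ∈ s, KContinuousNear (f i) z) : KContinuousNear (fun y => ∑ i ∈ s, f i y) z := by
  classical
  induction s using Finset.induction_on with
  | empty => simpa using KContinuousNear.zero z
  | insert i s hi ih =>
    simp only [Finset.sum_insert hi]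
    exact (hf i (Finset.mem_insert_self _ _)).add
      (ih fun j hj => hf j (Finset.mem_insert_of_mem hj))

theorem KContinuousNear.neg_one_pow_smul {f : Y → V} {z : Y} (hf : KContinuousNear f z) (n : ℕ) :
    KContinuousNear (fun y => (-1 : ℤ) ^ n • f y) z := by
  obtain h | h := neg_one_pow_eq_or ℤ n
  · simpa [h] using hf
  · simpa [h] using hf.neg

theorem KContinuousNear.smul {G : Type u} [TopologicalSpace G] [Group G] [DistribMulAction G V]
    [IsKModule G V] {f : Y → V} {z : Y} (hf : KContinuousNear f z) {g : Y → G}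
    (hg : Continuous g) : KContinuousNear (fun y => g y • f y) z := by
  obtain ⟨W, hW, hz, hfW⟩ := hf
  refine ⟨W, hW, hz, kContinuousOn_iff.2 fun S c hc => ?_⟩
  exact (kContinuous_iff _).1 (IsKModule.kContinuous_smul (G := G) (V := V)) S
    ⟨fun s => (g (c s), f (c s)),
      (hg.comp c.continuous).prodMk (kContinuousOn_iff.1 hfW S c hc)⟩

end Near

/-! ### The double complex of equivariant cochains -/

section Equivariant

variable {G V : Type u} [Group G] [TopologicalSpace G]
  [AddCommGroup V] [TopologicalSpace V] [IsKAddGroup V] [DistribMulAction G V]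

theorem mem_kcEq_iff {n : ℕ} {f : Cochain G V n} :
    f ∈ (kcEq G G V).carrier n ↔
      (∀ (g : G) (x : Fin (n + 1) → G), f (g • x) = g • f x) ∧ ∀ x, KContinuousNear f x :=
  ⟨fun h => ⟨h.2, fun x => KContinuous.near h.1 x⟩, fun h => ⟨kContinuous_of_near h.2, h.1⟩⟩

/-- The open covering is traded for a condition at each diagonal point. Conversely, a box around
`(y, …, y)` contains the cube on the intersection of its sides, and the bases of such cubes form the
covering. -/
theorem mem_kcgEq_iff {n : ℕ} {f : Cochain G V n} :
    f ∈ (kcgEq G G V).carrier n ↔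
      (∀ (g : G) (x : Fin (n + 1) → G), f (g • x) = g • f x) ∧
        ∀ y, KContinuousNear f fun _ => y := by
  constructor
  · rintro ⟨⟨U, hU, hf⟩, h⟩
    refine ⟨h, fun y => ?_⟩
    obtain ⟨A, hA, hy⟩ := Set.mem_sUnion.1 (hU.sUnion_eq ▸ Set.mem_univ y)
    refine (KContinuousOn.mono (t := {x : Fin (n + 1) → G | ∀ i, x i ∈ A}) hf
      fun x hx => ⟨A, hA, hx⟩).near ?_ fun _ => hy
    simp only [Set.ofPred_forall]
    exact isOpen_iInter_of_finite fun i => (hU.isOpen A hA).preimage (continuous_apply i)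
  · rintro ⟨h, hf⟩
    refine ⟨⟨{A | IsOpen A ∧ ∀ x : Fin (n + 1) → G, (∀ i, x i ∈ A) → KContinuousNear f x},
      ⟨fun A hA => hA.1, ?_⟩, ?_⟩, h⟩
    · refine Set.eq_univ_of_forall fun y => ?_
      have h1 := (isOpen_setOf_kContinuousNear f).mem_nhds (hf y)
      rw [nhds_pi, Filter.mem_pi'] at h1
      obtain ⟨J, t, ht, hJ⟩ := h1
      refine ⟨⋂ i, interior (t i), ⟨isOpen_iInter_of_finite fun i => isOpen_interior,
        fun x hx => hJ fun i _ => interior_subset (Set.mem_iInter.1 (hx i) i)⟩,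
        Set.mem_iInter.2 fun i => mem_interior_iff_mem_nhds.2 (ht i)⟩
    · refine kContinuousOn_of_near ?_
      rintro x ⟨A, hA, hx⟩
      exact hA.2 x hx

variable (G V) in
/-- The equivariant cochains of bidegree `(p, q)` which are continuous near the points
`(x, (y, …, y))`. -/
def biCochains (p q : ℕ) : AddSubgroup (BiCochain G V p q) where
  carrier := {f | (∀ (g : G) x y, f (g • x, g • y) = g • f (x, y)) ∧
    ∀ x y, KContinuousNear f (x, fun _ => y)}
  zero_mem' := ⟨fun g _ _ => (smul_zero g).symm, fun _ _ => KContinuousNear.zero _⟩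
  add_mem' := fun {a b} ha hb => ⟨fun g x y => by simp only [Pi.add_apply, smul_add, ha.1, hb.1],
    fun x y => (ha.2 x y).add (hb.2 x y)⟩
  neg_mem' := fun {a} ha => ⟨fun g x y => by simp only [Pi.neg_apply, smul_neg, ha.1],
    fun x y => (ha.2 x y).neg⟩

theorem diffL_mem {p q : ℕ} {f : BiCochain G V p q} (hf : f ∈ biCochains G V p q) :
    diffL p q f ∈ biCochains G V (p + 1) q := by
  constructor
  · intro g x y
    simp only [diffL_apply, diff_apply, Finset.smul_sum]
    refine Finset.sum_congr rfl fun i _ => ?_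
    rw [smul_comm, ← hf.1]
    rfl
  · intro x y
    have h : diffL p q f = fun z => ∑ i : Fin (p + 2), (-1 : ℤ) ^ (i : ℕ) •
        f (z.1 ∘ i.succAbove, z.2) := funext fun z => by rw [diffL_apply, diff_apply]
    rw [h]
    exact KContinuousNear.sum fun i _ => KContinuousNear.neg_one_pow_smul
      (KContinuousNear.comp (φ := fun z : (Fin (p + 2) → G) × (Fin (q + 1) → G) =>
        (z.1 ∘ i.succAbove, z.2)) (hf.2 _ _)
        (by fun_prop)) _

theorem diffR_mem {p q : ℕ} {f : BiCochain G V p q} (hf : f ∈ biCochains G V p q) :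
    diffR p q f ∈ biCochains G V p (q + 1) := by
  constructor
  · intro g x y
    simp only [diffR_apply, diff_apply, Finset.smul_sum]
    refine Finset.sum_congr rfl fun i _ => ?_
    rw [smul_comm g, smul_comm g, ← hf.1]
    rfl
  · intro x y
    have h : diffR p q f = fun z => (-1 : ℤ) ^ p • ∑ i : Fin (q + 2), (-1 : ℤ) ^ (i : ℕ) •
        f (z.1, z.2 ∘ i.succAbove) := funext fun z => by rw [diffR_apply, diff_apply]
    rw [h]
    exact KContinuousNear.neg_one_pow_smul (KContinuousNear.sum fun i _ =>
      KContinuousNear.neg_one_pow_smul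
      (KContinuousNear.comp (φ := fun z : (Fin (p + 1) → G) × (Fin (q + 2) → G) =>
        (z.1, z.2 ∘ i.succAbove)) (hf.2 _ _)
        (by fun_prop)) _) _

/-! ### Exactness of the rows -/

/-- The cone point `y 0` moves with the group, so the cone is equivariant; continuity survives
because the germ condition leaves `x` unrestricted. -/
theorem exists_diffL_eq {p q : ℕ} {f : BiCochain G V (p + 1) q}
    (hf : f ∈ biCochains G V (p + 1) q) (h : diffL (p + 1) q f = 0) :
    ∃ b ∈ biCochains G V p q, diffL p q b = f := by
  refine ⟨fun z => f ((Fin.cons (z.2 0) z.1 : Fin (p + 2) → G), z.2), ⟨fun g x y => ?_,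
    fun x y => ?_⟩, ?_⟩
  · rw [← hf.1]
    refine congrArg f (Prod.ext (funext fun j => ?_) rfl)
    refine Fin.cases ?_ (fun j => ?_) j <;> rfl
  · refine KContinuousNear.comp
      (φ := fun z : (Fin (p + 1) → G) × (Fin (q + 1) → G) =>
        ((Fin.cons (z.2 0) z.1 : Fin (p + 2) → G), z.2)) (hf.2 _ y) ?_
    refine Continuous.prodMk (continuous_pi fun j => ?_) continuous_snd
    refine Fin.cases ?_ (fun j => ?_) j
    · exact (continuous_apply (0 : Fin (q + 1))).comp
        (continuous_snd (X := Fin (p + 1) → G) (Y := Fin (q + 1) → G))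
    · exact (continuous_apply j).comp
        (continuous_fst (X := Fin (p + 1) → G) (Y := Fin (q + 1) → G))
  · funext z
    have h1 := congrFun h ((Fin.cons (z.2 0) z.1 : Fin (p + 3) → G), z.2)
    rw [diffL_apply, diff_cons] at h1
    rw [diffL_apply]
    exact (sub_eq_zero.1 h1).symm

theorem exists_eq_right {q : ℕ} {f : BiCochain G V 0 q}
    (hf : f ∈ biCochains G V 0 q) (h : diffL 0 q f = 0) :
    ∃ F ∈ (kcgEq G G V).carrier q, ∀ x y, f (x, y) = F y := by
  refine ⟨fun y => f (fun _ => y 0, y), mem_kcgEq_iff.2 ⟨fun g y => ?_, fun y => ?_⟩,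
    fun x y => ?_⟩
  · exact hf.1 g (fun _ => y 0) y
  · exact KContinuousNear.comp
      (φ := fun y : Fin (q + 1) → G => ((fun _ => y 0 : Fin (0 + 1) → G), y)) (hf.2 _ y)
      (by fun_prop)
  · have h1 := congrFun h (![y 0, x 0], y)
    rw [diffL_apply, diff_apply, Fin.sum_univ_two] at h1
    simp only [Fin.val_zero, pow_zero, one_smul, Fin.val_one, pow_one, neg_smul, Pi.zero_apply]
      at h1
    have h2 := eq_of_sub_eq_zero ((sub_eq_add_neg _ _).trans h1)
    convert h2 using 3
    · funext i; fin_cases i; rfl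
    · funext i; fin_cases i; rfl

/-- A one-entry tuple is always diagonal, so `f` is continuous near every point. Since `f` does not
depend on `y`, it may be evaluated at `x 0`, which keeps equivariance. -/
theorem exists_eq_left {p : ℕ} {f : BiCochain G V p 0}
    (hf : f ∈ biCochains G V p 0) (h : diffR p 0 f = 0) :
    ∃ F ∈ (kcEq G G V).carrier p, ∀ x y, f (x, y) = F x := by
  refine ⟨fun x => f (x, fun _ => x 0), mem_kcEq_iff.2 ⟨fun g x => ?_, fun x => ?_⟩,
    fun x y => ?_⟩
  · exact hf.1 g x fun _ => x 0
  · exact KContinuousNear.comp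
      (φ := fun x : Fin (p + 1) → G => (x, (fun _ => x 0 : Fin (0 + 1) → G))) (hf.2 x _)
      (by fun_prop)
  · have h1 := congrFun ((diffR_eq_zero_iff f).1 h x) ![x 0, y 0]
    rw [diff_apply, Fin.sum_univ_two] at h1
    simp only [Fin.val_zero, pow_zero, one_smul, Fin.val_one, pow_one, neg_smul, Pi.zero_apply]
      at h1
    have h2 := eq_of_sub_eq_zero ((sub_eq_add_neg _ _).trans h1)
    convert h2 using 3
    · funext i; fin_cases i; rfl
    · funext i; fin_cases i; rfl

/-! ### Edge embeddings and the image of the Alexander–Whitney map. -/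

theorem left_mem {p : ℕ} {F : Cochain G V p} (hF : F ∈ (kcEq G G V).carrier p) :
    (fun z => F z.1 : BiCochain G V p 0) ∈ biCochains G V p 0 :=
  ⟨fun g x _ => (mem_kcEq_iff.1 hF).1 g x,
    fun x _ => ((mem_kcEq_iff.1 hF).2 x).comp continuous_fst⟩

theorem right_mem {q : ℕ} {F : Cochain G V q} (hF : F ∈ (kcgEq G G V).carrier q) :
    (fun z => F z.2 : BiCochain G V 0 q) ∈ biCochains G V 0 q :=
  ⟨fun g _ y => (mem_kcgEq_iff.1 hF).1 g y,
    fun _ y => ((mem_kcgEq_iff.1 hF).2 y).comp continuous_snd⟩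

theorem alexanderWhitney_mem {k : ∀ p q, BiCochain G V p q}
    (hk : ∀ p q, k p q ∈ biCochains G V p q) (n : ℕ) :
    alexanderWhitney k n ∈ (kcgEq G G V).carrier n := by
  refine mem_kcgEq_iff.2 ⟨fun g x => ?_, fun y => ?_⟩
  · simp only [alexanderWhitney, Finset.smul_sum, ← (hk _ _).1]
    rfl
  · refine KContinuousNear.sum fun a _ => ?_
    refine KContinuousNear.comp (φ := fun x : Fin (n + 1) → G =>
      ((fun i => seq x i : Fin (a.1 + 1) → G), (fun j => seq x (a.1 + j) : Fin (a.2 + 1) → G)))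
      ((hk _ _).2 _ y) ?_
    exact (continuous_pi fun i => continuous_apply _).prodMk
      (continuous_pi fun i => continuous_apply _)

end Equivariant

/-! ### Exactness of the columns -/

/-- A contractible topological group `G` admits a translation invariant family of contractions of
`G` to the points `x * c`. -/
theorem exists_equivariant_contraction (G : Type u) [Group G] [TopologicalSpace G]
    [IsTopologicalGroup G] [ContractibleSpace G] :
    ∃ (c : G) (K : G × G × I → G), Continuous K ∧
      (∀ g x y t, K (g * x, g * y, t) = g * K (x, y, t)) ∧
      (∀ x y, K (x, y, 0) = y) ∧ ∀ x y, K (x, y, 1) = x * c := by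
  obtain ⟨c, ⟨H⟩⟩ := id_nullhomotopic G
  -- Conjugating the contraction by translation by `x` makes it equivariant under simultaneous
  -- translation of `x` and `y`.
  refine ⟨c, fun z => z.1 * H (z.2.2, z.1⁻¹ * z.2.1), by fun_prop, fun g x y t => ?_,
    fun x y => ?_, fun x y => ?_⟩
  · simp [mul_assoc]
  · simp
  · simp

/-! ### The sum of prism operators along a sequence of maps. -/

section Sweep

variable {G V : Type u} [Group G] [AddCommGroup V]

/-- Cochains are not normalised, so a prism between equal constant maps need not vanish. Its value
is the correction subtracted in `sweep`, which makes the sum finite. -/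
theorem prism_const {X V : Type u} [AddCommGroup V] {n : ℕ} {s t : X → X} {a : X}
    (f : Cochain X V (n + 1)) (x : Fin (n + 1) → X) (hs : ∀ m, s (x m) = a)
    (ht : ∀ m, t (x m) = a) : prism s t f x = prism (fun _ => a) (fun _ => a) f x := by
  refine Finset.sum_congr rfl fun j _ => ?_
  congr 2
  funext m
  simp [prismVertex, seq, hs, ht]

/-- The homotopy operator swept out by a sequence of maps which ends in a constant map. -/
noncomputable def sweep (c : G) {p : ℕ} (s : ℕ → (Fin (p + 1) → G) → G → G) {q : ℕ}
    (f : BiCochain G V p (q + 1)) : BiCochain G V p q := fun z =>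
  ∑ᶠ i, (prism (s i z.1) (s (i + 1) z.1) (fun y => f (z.1, y)) z.2 -
    prism (fun _ => z.1 0 * c) (fun _ => z.1 0 * c) (fun y => f (z.1, y)) z.2)

theorem sweep_eq_sum {c : G} {p : ℕ} {s : ℕ → (Fin (p + 1) → G) → G → G} {q : ℕ}
    (f : BiCochain G V p (q + 1)) {x : Fin (p + 1) → G} {y : Fin (q + 1) → G} {N : ℕ}
    (hN : ∀ m, ∀ i ≥ N, s i x (y m) = x 0 * c) :
    sweep c s f (x, y) = ∑ i ∈ Finset.range N,
      (prism (s i x) (s (i + 1) x) (fun y => f (x, y)) y -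
        prism (fun _ => x 0 * c) (fun _ => x 0 * c) (fun y => f (x, y)) y) := by
  refine finsum_eq_sum_of_support_subset _ fun i hi => ?_
  by_contra hiN
  simp only [Finset.coe_range, Set.mem_Iio, not_lt] at hiN
  refine hi (sub_eq_zero.2 (prism_const _ _ (fun m => hN m i hiN) fun m => hN m _ (by omega)))

/-- On a cocycle each prism contributes the difference between consecutive maps and each constant
correction contributes zero, so the sum telescopes from the identity to the constant map. -/
theorem diff_sweep {c : G} {p : ℕ} {s : ℕ → (Fin (p + 1) → G) → G → G} {q : ℕ}
    {f : BiCochain G V p (q + 1)} (hs0 : ∀ x y, s 0 x y = y)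
    (hsN : ∀ x y, ∃ N, ∀ i ≥ N, s i x y = x 0 * c) (x : Fin (p + 1) → G)
    (hf : diff G V (q + 1) (fun y => f (x, y)) = 0) (y : Fin (q + 2) → G) :
    diff G V q (fun y => sweep c s f (x, y)) y = f (x, fun _ => x 0 * c) - f (x, y) := by
  choose N hN using fun m => hsN x (y m)
  have hM : ∀ m, ∀ i ≥ Finset.univ.sup N, s i x (y m) = x 0 * c := fun m i hi =>
    hN m i ((Finset.le_sup (Finset.mem_univ m)).trans hi)
  generalize Finset.univ.sup N = M at hM
  let B : ℕ → Cochain G V q := fun i => prism (s i x) (s (i + 1) x) (fun y => f (x, y)) -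
    prism (fun _ => x 0 * c) (fun _ => x 0 * c) fun y => f (x, y)
  have h1 : diff G V q (fun y => sweep c s f (x, y)) y =
      diff G V q (∑ i ∈ Finset.range M, B i) y := by
    rw [diff_apply, diff_apply]
    refine Finset.sum_congr rfl fun i _ => ?_
    rw [sweep_eq_sum (y := y ∘ i.succAbove) f fun m => hM (i.succAbove m), Finset.sum_apply]
    rfl
  have hP : ∀ s t : G → G, diff G V q (prism s t fun y => f (x, y)) y =
      f (x, t ∘ y) - f (x, s ∘ y) := by
    intro s t
    have := diff_prism s t (fun y => f (x, y)) y
    rw [hf] at this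
    rw [← this]
    simp [prism]
  have hB : ∀ i, diff G V q (B i) y = f (x, s (i + 1) x ∘ y) - f (x, s i x ∘ y) := by
    intro i
    rw [map_sub, Pi.sub_apply, hP, hP, sub_self, sub_zero]
  rw [h1, map_sum, Finset.sum_apply, Finset.sum_congr rfl fun i _ => hB i,
    Finset.sum_range_sub (fun i => f (x, s i x ∘ y))]
  congr 3
  · exact funext fun m => hM m M le_rfl
  · exact funext fun m => hs0 x (y m)

end Sweep

theorem KContinuousNear.prism {G V : Type u} [TopologicalSpace G] [TopologicalSpace V]
    [AddCommGroup V] [IsKAddGroup V] {p : ℕ} {s t : (Fin (p + 1) → G) → G → G} {q : ℕ}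
    {f : BiCochain G V p (q + 1)}
    (hs : Continuous fun z : (Fin (p + 1) → G) × G => s z.1 z.2)
    (ht : Continuous fun z : (Fin (p + 1) → G) × G => t z.1 z.2) {x : Fin (p + 1) → G} {y : G}
    (h : ∀ j, KContinuousNear f (x, fun m => prismVertex (s x) (t x) j (fun _ => y) m)) :
    KContinuousNear (fun z : (Fin (p + 1) → G) × (Fin (q + 1) → G) =>
      KCohomology.prism (s z.1) (t z.1) (fun y => f (z.1, y)) z.2) (x, fun _ => y) := by
  refine KContinuousNear.sum fun j _ => KContinuousNear.neg_one_pow_smul ?_ j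
  refine KContinuousNear.comp (φ := fun z : (Fin (p + 1) → G) × (Fin (q + 1) → G) =>
    (z.1, (fun m => prismVertex (s z.1) (t z.1) j (seq z.2) m : Fin (q + 2) → G))) (h j) ?_
  refine continuous_fst.prodMk (continuous_pi fun m => ?_)
  simp only [prismVertex, seq]
  split_ifs
  · exact hs.comp (continuous_fst.prodMk ((continuous_apply _).comp continuous_snd))
  · exact ht.comp (continuous_fst.prodMk ((continuous_apply _).comp continuous_snd))

/-! ### Short equivariant steps and the contracting homotopy. -/

section Columns

variable {G V : Type u} [Group G] [TopologicalSpace G]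
  [AddCommGroup V] [TopologicalSpace V] [IsKAddGroup V] [DistribMulAction G V]

theorem exists_uniform_step {p q : ℕ} {f : BiCochain G V p q} (hf : f ∈ biCochains G V p q)
    {K : G × G × I → G} (hK : Continuous K) (z : (Fin (p + 1) → G) × G) :
    ∃ δ > 0, ∀ᶠ z' : (Fin (p + 1) → G) × G in 𝓝 z, ∀ τ : Fin (q + 1) → I,
      (∀ m, dist (τ m) (τ 0) ≤ δ) →
        KContinuousNear f (z'.1, fun m => K (z'.1 0, z'.2, τ m)) := by
  let Φ : ((Fin (p + 1) → G) × G) × (Fin (q + 1) → I) → (Fin (p + 1) → G) × (Fin (q + 1) → G) :=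
    fun w => (w.1.1, fun m => K (w.1.1 0, w.1.2, w.2 m))
  have hΦ : Continuous Φ := by fun_prop
  have hD : IsCompact (Set.range fun (t : I) (_ : Fin (q + 1)) => t) :=
    isCompact_range (by fun_prop)
  -- Equal times give a diagonal point, where `f` is continuous; the diagonal of the time cube is
  -- compact, so this holds for nearly equal times uniformly near `z`.
  obtain ⟨u, v, hu, hv, hzu, hDv, huv⟩ := generalized_tube_lemma (isCompact_singleton (x := z)) hD
    ((isOpen_setOf_kContinuousNear f).preimage hΦ) (by
      rintro ⟨z', τ⟩ ⟨hz', t, rfl⟩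
      exact hf.2 z'.1 (K (z'.1 0, z'.2, t)))
  obtain ⟨δ, hδ, hδv⟩ := hD.exists_cthickening_subset_open hv hDv
  refine ⟨δ, hδ, ?_⟩
  filter_upwards [hu.mem_nhds (hzu rfl)] with z' hz' τ hτ
  refine huv (Set.mk_mem_prod hz' (hδv ?_))
  exact Metric.mem_cthickening_of_dist_le τ (fun _ => τ 0) δ _ ⟨τ 0, rfl⟩
    ((dist_pi_le_iff hδ.le).2 hτ)

theorem prism_smul {p : ℕ} {s t : (Fin (p + 1) → G) → G → G} {q : ℕ}
    {f : BiCochain G V p (q + 1)} (hf : f ∈ biCochains G V p (q + 1))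
    (hs : ∀ (g : G) x y, s (g • x) (g * y) = g * s x y)
    (ht : ∀ (g : G) x y, t (g • x) (g * y) = g * t x y)
    (g : G) (x : Fin (p + 1) → G) (y : Fin (q + 1) → G) :
    prism (s (g • x)) (t (g • x)) (fun y => f (g • x, y)) (g • y) =
      g • prism (s x) (t x) (fun y => f (x, y)) y := by
  simp only [prism, Finset.smul_sum]
  refine Finset.sum_congr rfl fun j _ => ?_
  rw [smul_comm, ← hf.1]
  congr 3
  funext m
  simp only [prismVertex, seq, Pi.smul_apply, smul_eq_mul, hs, ht]
  split_ifs <;> rfl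

variable [IsTopologicalGroup G]

/-- By equivariance and `k`-continuity of the action, the locus of local continuity of `f` is
`G`-invariant. -/
theorem KContinuousNear.translate [IsKModule G V] {p q : ℕ} {f : BiCochain G V p q}
    (hf : f ∈ biCochains G V p q) (g : G) {x : Fin (p + 1) → G} {y : Fin (q + 1) → G}
    (h : KContinuousNear f (x, y)) : KContinuousNear f (g • x, g • y) := by
  have h1 : f = fun z => g • f (g⁻¹ • z.1, g⁻¹ • z.2) := funext fun z => by
    rw [← hf.1, smul_inv_smul, smul_inv_smul]
  rw [h1]
  refine KContinuousNear.smul (KContinuousNear.comp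
    (φ := fun z : (Fin (p + 1) → G) × (Fin (q + 1) → G) => (g⁻¹ • z.1, g⁻¹ • z.2)) ?_
    (by fun_prop)) continuous_const
  simpa using h

/-- The existence of an equivariant sequence of maps from the identity to a constant map, whose
steps are so small that the prisms they span stay where `f` is continuous. -/
theorem exists_small_steps [ContractibleSpace G] [IsKModule G V] {p q : ℕ}
    (hG : HasStepFunctions ((Fin (p + 1) → G) × G))
    {f : BiCochain G V p q} (hf : f ∈ biCochains G V p q) :
    ∃ (c : G) (s : ℕ → (Fin (p + 1) → G) → G → G),
      (∀ i, Continuous fun z : (Fin (p + 1) → G) × G => s i z.1 z.2) ∧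
      (∀ i (g : G) x y, s i (g • x) (g * y) = g * s i x y) ∧
      (∀ x y, s 0 x y = y) ∧
      (∀ z : (Fin (p + 1) → G) × G, ∃ N, ∀ᶠ z' : (Fin (p + 1) → G) × G in 𝓝 z,
        ∀ i ≥ N, s i z'.1 z'.2 = z'.1 0 * c) ∧
      ∀ i j x y, KContinuousNear f
        (x, fun m => prismVertex (s i x) (s (i + 1) x) j (fun _ => y) m) := by
  obtain ⟨c, K, hK, hKg, hK0, hK1⟩ := exists_equivariant_contraction G
  obtain ⟨e, he, heS⟩ := hG (fun z => {δ | ∀ τ : Fin (q + 1) → I,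
      (∀ m, dist (τ m) (τ 0) ≤ δ) → KContinuousNear f (z.1, fun m => K (z.1 0, z.2, τ m))})
    (fun z δ δ' _ hδ h τ hτ => h τ fun m => (hτ m).trans hδ)
    (exists_uniform_step hf hK)
  -- The selected step size need not be invariant. Evaluating it after translating `x 0` to the
  -- identity makes it so, and `KContinuousNear.translate` carries admissibility back.
  let ε : (Fin (p + 1) → G) × G → ℝ := fun z => e ((z.1 0)⁻¹ • z.1, (z.1 0)⁻¹ * z.2)
  have hε : Continuous ε := by
    refine he.comp (Continuous.prodMk ?_ (by fun_prop))
    exact continuous_pi fun m => by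
      simp only [Pi.smul_apply, smul_eq_mul]
      fun_prop
  have hεpos : ∀ z, 0 < ε z := fun z => (heS _).1
  have hεg : ∀ (g : G) x y, ε (g • x, g * y) = ε (x, y) := by
    intro g x y
    simp [ε, mul_smul, mul_assoc]
  have hεS : ∀ x y (τ : Fin (q + 1) → I), (∀ m, dist (τ m) (τ 0) ≤ ε (x, y)) →
      KContinuousNear f (x, fun m => K (x 0, y, τ m)) := by
    intro x y τ hτ
    have h := KContinuousNear.translate hf (x 0) ((heS ((x 0)⁻¹ • x, (x 0)⁻¹ * y)).2 τ hτ)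
    convert h using 2
    · simp
    · funext m
      simp [← hKg]
  refine ⟨c, fun i x y => K (x 0, y, Set.projIcc 0 1 zero_le_one (i * ε (x, y))), fun i => ?_,
    fun i g x y => ?_, fun x y => ?_, fun z => ?_, fun i j x y => ?_⟩
  · have := continuous_projIcc (a := (0 : ℝ)) (b := 1) (h := zero_le_one)
    fun_prop
  · dsimp only
    rw [hεg, ← hKg]
    rfl
  · simp [hK0]
  -- Near `z` the step size exceeds `ε z / 2`, so this many steps reach time `1` throughout a
  -- neighbourhood.
  · obtain ⟨N, hN⟩ := exists_nat_ge (1 / (ε z / 2))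
    have h2 : 0 < ε z / 2 := half_pos (hεpos z)
    refine ⟨N, ?_⟩
    filter_upwards [hε.tendsto z (Ioi_mem_nhds (half_lt_self (hεpos z)))] with z' hz' i hi
    have hz2 : ε z / 2 < ε z' := hz'
    have h1 : 1 ≤ (i : ℝ) * ε z' := by
      rw [div_le_iff₀ h2] at hN
      have hi' : (N : ℝ) ≤ i := by exact_mod_cast hi
      calc (1 : ℝ) ≤ N * (ε z / 2) := hN
        _ ≤ i * ε z' := mul_le_mul hi' hz2.le h2.le (Nat.cast_nonneg i)
    rw [Set.projIcc_of_right_le _ h1]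
    exact hK1 _ _
  -- All prism vertices lie at time `i * ε` or `(i + 1) * ε`, clamped to the unit interval; clamping
  -- does not increase distances, so they are within `ε` of vertex `0`.
  · have h := hεS x y (fun m => Set.projIcc 0 1 zero_le_one
      ((if (m : ℕ) ≤ j then (i : ℝ) else (i + 1 : ℕ)) * ε (x, y))) (fun m => by
        rw [Subtype.dist_eq, Real.dist_eq]
        refine (Set.abs_projIcc_sub_projIcc _).trans ?_
        rw [← sub_mul, abs_mul, abs_of_pos (hεpos _)]
        refine mul_le_of_le_one_left (hεpos _).le ?_
        simp only [Fin.val_zero, Nat.zero_le, if_true]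
        split_ifs <;> simp)
    convert h using 2
    funext m
    simp only [prismVertex]
    split_ifs <;> rfl

/-- Near a diagonal point all coordinates reach the constant map by a common step, so the sum is
locally a fixed finite sum of prisms lying where `f` is continuous. -/
theorem sweep_mem {c : G} {p : ℕ} {s : ℕ → (Fin (p + 1) → G) → G → G} {q : ℕ}
    {f : BiCochain G V p (q + 1)} (hf : f ∈ biCochains G V p (q + 1))
    (hs : ∀ i, Continuous fun z : (Fin (p + 1) → G) × G => s i z.1 z.2)
    (hsg : ∀ i (g : G) x y, s i (g • x) (g * y) = g * s i x y)
    (hsN : ∀ z : (Fin (p + 1) → G) × G, ∃ N, ∀ᶠ z' : (Fin (p + 1) → G) × G in 𝓝 z,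
        ∀ i ≥ N, s i z'.1 z'.2 = z'.1 0 * c)
    (hsf : ∀ i j x y, KContinuousNear f
        (x, fun m => prismVertex (s i x) (s (i + 1) x) j (fun _ => y) m)) :
    sweep c s f ∈ biCochains G V p q := by
  constructor
  · intro g x y
    choose N hN using fun m => hsN (x, y m)
    have hM : ∀ m, ∀ i ≥ Finset.univ.sup N, s i x (y m) = x 0 * c := fun m i hi =>
      (hN m).self_of_nhds i ((Finset.le_sup (Finset.mem_univ m)).trans hi)
    rw [sweep_eq_sum f hM, sweep_eq_sum (N := Finset.univ.sup N) f fun m i hi => by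
      rw [Pi.smul_apply, smul_eq_mul, hsg, hM m i hi]
      simp [mul_assoc], Finset.smul_sum]
    refine Finset.sum_congr rfl fun i _ => ?_
    rw [smul_sub, ← prism_smul hf (hsg i) (hsg (i + 1)),
      ← prism_smul (G := G) (s := fun x _ => x 0 * c) (t := fun x _ => x 0 * c) hf
        (fun g x _ => by simp [mul_assoc]) (fun g x _ => by simp [mul_assoc])]
  · intro x y
    obtain ⟨N, hN⟩ := hsN (x, y)
    have hev : ∀ᶠ z : (Fin (p + 1) → G) × (Fin (q + 1) → G) in 𝓝 (x, fun _ => y),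
        ∀ m, ∀ i ≥ N, s i z.1 (z.2 m) = z.1 0 * c := by
      rw [eventually_all]
      intro m
      have hc : Continuous fun z : (Fin (p + 1) → G) × (Fin (q + 1) → G) => (z.1, z.2 m) := by
        fun_prop
      exact (hc.tendsto (x, fun _ => y)).eventually hN
    have hx : Continuous fun z : (Fin (p + 1) → G) × G => z.1 0 * c := by fun_prop
    refine KContinuousNear.congr (KContinuousNear.sum (s := Finset.range N) fun i _ =>
      KContinuousNear.add (KContinuousNear.prism (hs i) (hs (i + 1)) (hsf i · x y))
        (KContinuousNear.prism (f := f) (s := fun x _ => x 0 * c) (t := fun x _ => x 0 * c)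
          hx hx fun j => ?_).neg) (hev.mono fun z hz => ?_)
    · simp only [prismVertex, ite_self]
      exact hf.2 _ _
    · rw [sweep_eq_sum f hz]
      simp only [sub_eq_add_neg]

theorem exists_diffR_eq [ContractibleSpace G] [IsKModule G V] {p q : ℕ}
    (hG : HasStepFunctions ((Fin (p + 1) → G) × G))
    {f : BiCochain G V p (q + 1)} (hf : f ∈ biCochains G V p (q + 1))
    (h : diffR p (q + 1) f = 0) : ∃ b ∈ biCochains G V p q, diffR p q b = f := by
  rw [diffR_eq_zero_iff] at h
  obtain ⟨c, s, hs, hsg, hs0, hsN, hsf⟩ := exists_small_steps hG hf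
  let b : BiCochain G V p q := fun z => f (z.1, fun _ => z.1 0 * c) - sweep c s f z
  have hconst : (fun z => f (z.1, fun _ => z.1 0 * c) : BiCochain G V p q) ∈
      biCochains G V p q := by
    constructor
    · intro g x y
      rw [← hf.1]
      refine congrArg f (Prod.ext rfl (funext fun m => ?_))
      simp [mul_assoc]
    · intro x y
      exact KContinuousNear.comp (φ := fun z : (Fin (p + 1) → G) × (Fin (q + 1) → G) =>
        (z.1, (fun _ => z.1 0 * c : Fin (q + 2) → G))) (hf.2 _ _) (by fun_prop)
  have hb : b ∈ biCochains G V p q := sub_mem hconst (sweep_mem hf hs hsg hsN hsf)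
  refine ⟨(-1 : ℤ) ^ p • b, zsmul_mem hb _, funext fun z => ?_⟩
  have h1 : diffR p q ((-1 : ℤ) ^ p • b) z = diff G V q (fun y => b (z.1, y)) z.2 := by
    have h2 : (-1 : ℤ) ^ p * (-1 : ℤ) ^ p = 1 := by rw [← mul_pow]; simp
    rw [map_zsmul, Pi.smul_apply, diffR_apply, smul_smul, h2, one_smul]
  have hsw := diff_sweep hs0 (fun x y => (hsN (x, y)).imp fun N hN => hN.self_of_nhds) z.1
    (h z.1) z.2
  have hbz : (fun y => b (z.1, y)) = (fun _ => f (z.1, fun _ => z.1 0 * c)) -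
      fun y => sweep c s f (z.1, y) := rfl
  have hsum : ∀ n, (∑ i : Fin n, (-1 : ℤ) ^ (i : ℕ) • f (z.1, fun _ => z.1 0 * c)) =
      if Even n then 0 else f (z.1, fun _ => z.1 0 * c) := by
    intro n
    rw [← Finset.sum_smul, Fin.sum_neg_one_pow]
    split_ifs <;> simp
  rw [h1, hbz, map_sub, Pi.sub_apply, hsw, diff_apply, hsum]
  -- The coboundary of a constant `q`-cochain vanishes for even `q`. In that case the cocycle
  -- condition at a constant tuple has an odd number of terms and forces the constant itself to be
  -- zero.
  split_ifs with hq
  · have hc := congrFun (h z.1) fun _ => z.1 0 * c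
    rw [diff_apply] at hc
    have hc' : f (z.1, fun _ => z.1 0 * c) = 0 := by
      refine Eq.trans ?_ hc
      have := hsum (q + 1 + 2)
      rw [if_neg (by rw [show q + 1 + 2 = q + 2 + 1 by ring, Nat.even_add_one]; simpa using hq)]
        at this
      exact this.symm
    rw [hc']
    abel
  · abel

end Columns

/-! ### Comparison of the edges of the double complex -/

section Total

variable {X V : Type u} [AddCommGroup V]

/-- The total differential of a family of functions of all bidegrees. -/
def total (k : ∀ p q, BiCochain X V p q) (p q : ℕ) : BiCochain X V p q :=
  horizontal diffL k p q + vertical diffR k p q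

/-- The family of functions of the first group of variables only, on the bottom row. -/
def leftFamily (F : ∀ p, Cochain X V p) : ∀ p q, BiCochain X V p q
  | p, 0 => fun z => F p z.1
  | _, _ + 1 => 0

/-- The family of functions of the second group of variables only, in the first column. -/
def rightFamily (f : ∀ q, Cochain X V q) : ∀ p q, BiCochain X V p q
  | 0, q => fun z => f q z.2
  | _ + 1, _ => 0

theorem total_add (k l : ∀ p q, BiCochain X V p q) (p q : ℕ) :
    total (fun p q => k p q + l p q) p q = total k p q + total l p q := by
  cases p <;> cases q <;> simp only [total, horizontal, vertical, map_add] <;> abel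

theorem total_total_succ_zero (k : ∀ p q, BiCochain X V p q) (p : ℕ) :
    total (total k) (p + 1) 0 = 0 := by
  cases p <;> simp [total, horizontal, vertical, diffL_diffL]

theorem total_leftFamily_succ_zero (F : ∀ p, Cochain X V p) (p : ℕ) :
    total (leftFamily F) (p + 1) 0 = fun z => diff X V p (F p) z.1 :=
  add_zero _

theorem total_leftFamily_succ (F : ∀ p, Cochain X V p) (p q : ℕ) :
    total (leftFamily F) p (q + 1) = 0 := by
  have h : ∀ p q, diffR p q (leftFamily F p q) = 0 := by
    intro p q
    cases q with
    | zero =>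
      rw [diffR_eq_zero_iff]
      intro x
      funext y
      rw [diff_apply, Fin.sum_univ_two]
      simp [leftFamily]
    | succ q => exact map_zero _
  cases p with
  | zero => simp [total, horizontal, vertical, h]
  | succ p => exact (congrArg₂ (· + ·) (map_zero (diffL p (q + 1))) (h _ _)).trans (add_zero 0)

theorem total_rightFamily_zero_zero (f : ∀ q, Cochain X V q) : total (rightFamily f) 0 0 = 0 :=
  add_zero _

theorem total_rightFamily_zero_succ (f : ∀ q, Cochain X V q) (q : ℕ) :
    total (rightFamily f) 0 (q + 1) = fun z => diff X V q (f q) z.2 := by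
  funext z
  simp [total, horizontal, vertical, diffR_apply, rightFamily]

theorem total_rightFamily_succ (f : ∀ q, Cochain X V q) (p q : ℕ) :
    total (rightFamily f) (p + 1) q = 0 := by
  have h : ∀ p q, diffL p q (rightFamily f p q) = 0 := by
    intro p q
    cases p with
    | zero =>
      funext z
      rw [diffL_apply, diff_apply, Fin.sum_univ_two]
      simp [rightFamily]
    | succ p => exact map_zero _
  cases q with
  | zero => simp [total, horizontal, vertical, h]
  | succ q => exact (congrArg₂ (· + ·) (h _ _) (map_zero (diffR (p + 1) q))).trans (add_zero 0)

theorem alexanderWhitney_leftFamily (F : ∀ p, Cochain X V p) (n : ℕ) :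
    alexanderWhitney (leftFamily F) n = F n :=
  alexanderWhitney_left F _ (fun _ _ _ => rfl) (fun _ _ => rfl) n

theorem alexanderWhitney_rightFamily (f : ∀ q, Cochain X V q) (n : ℕ) :
    alexanderWhitney (rightFamily f) n = f n :=
  alexanderWhitney_right f _ (fun _ _ _ => rfl) (fun _ _ => rfl) n

theorem single_mem {C : Subcomplex X V} {n : ℕ} {f : Cochain X V n} (hf : f ∈ C.carrier n)
    (m : ℕ) : (Pi.single n f : ∀ q, Cochain X V q) m ∈ C.carrier m := by
  by_cases h : m = n
  · subst h
    rwa [Pi.single_eq_same]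
  · rw [Pi.single_eq_of_ne h]
    exact zero_mem _

end Total

/-! ### Transfer of cocycles between the two edges. -/

section Comparison

variable {G V : Type u} [Group G] [TopologicalSpace G]
  [AddCommGroup V] [TopologicalSpace V] [IsKAddGroup V] [DistribMulAction G V]

variable (G V) in
/-- The horizontal differential on equivariant cochains. -/
def restrictedDiffL (p q : ℕ) : biCochains G V p q →+ biCochains G V (p + 1) q :=
  ((diffL p q).comp (biCochains G V p q).subtype).codRestrict _ fun f => diffL_mem f.2

variable (G V) in
/-- The vertical differential on equivariant cochains. -/
def restrictedDiffR (p q : ℕ) : biCochains G V p q →+ biCochains G V p (q + 1) :=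
  ((diffR p q).comp (biCochains G V p q).subtype).codRestrict _ fun f => diffR_mem f.2

theorem coe_horizontal (k : ∀ p q, biCochains G V p q) (p q : ℕ) :
    (horizontal (restrictedDiffL G V) k p q : BiCochain G V p q) =
      horizontal diffL (fun p q => (k p q : BiCochain G V p q)) p q := by
  cases p <;> rfl

theorem coe_vertical (k : ∀ p q, biCochains G V p q) (p q : ℕ) :
    (vertical (restrictedDiffR G V) k p q : BiCochain G V p q) =
      vertical diffR (fun p q => (k p q : BiCochain G V p q)) p q := by
  cases q <;> rfl

theorem exists_eq_total_add_leftFamily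
    (exact : ∀ p q, ∀ f ∈ biCochains G V p (q + 1), diffR p (q + 1) f = 0 →
      ∃ b ∈ biCochains G V p q, diffR p q b = f)
    {l : ∀ p q, BiCochain G V p q} (hl : ∀ p q, l p q ∈ biCochains G V p q)
    (hD : ∀ p q, total l p (q + 1) = 0) :
    ∃ k : ∀ p q, BiCochain G V p q, (∀ p q, k p q ∈ biCochains G V p q) ∧
      ∃ F : ∀ p, Cochain G V p, (∀ p, F p ∈ (kcEq G G V).carrier p) ∧
        l = fun p q => total k p q + leftFamily F p q := by
  obtain ⟨k, hk, hk0⟩ := exists_eq_total_differential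
    (h := restrictedDiffL G V) (v := restrictedDiffR G V)
    (fun p q a => Subtype.ext (diffL_diffL a.1)) (fun p q a => Subtype.ext (diffL_diffR a.1))
    (fun p q a ha => by
      obtain ⟨b, hb, hba⟩ := exact p q a.1 a.2 (congrArg Subtype.val ha)
      exact ⟨⟨b, hb⟩, Subtype.ext hba⟩)
    (fun p q => ⟨l p q, hl p q⟩)
    (fun p q => Subtype.ext (by
      rw [AddSubgroup.coe_add, coe_horizontal, coe_vertical]
      exact hD p q))
  choose F hF hFl using fun p => exists_eq_left
    (f := l p 0 - (horizontal (restrictedDiffL G V) k p 0).1)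
    (sub_mem (hl p 0) (horizontal (restrictedDiffL G V) k p 0).2) (congrArg Subtype.val (hk0 p))
  refine ⟨fun p q => k p q, fun p q => (k p q).2, F, hF, funext fun p => funext fun q => ?_⟩
  cases q with
  | zero =>
    have h1 : l p 0 - (horizontal (restrictedDiffL G V) k p 0).1 = leftFamily F p 0 :=
      funext fun z => hFl p z.1 z.2
    rw [← h1, coe_horizontal]
    simp [total, vertical]
  | succ q =>
    have h1 := congrArg Subtype.val (hk p q)
    rw [AddSubgroup.coe_add, coe_horizontal, coe_vertical] at h1
    exact h1.trans (add_zero _).symm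

theorem exists_eq_total_add_rightFamily
    {l : ∀ p q, BiCochain G V p q} (hl : ∀ p q, l p q ∈ biCochains G V p q)
    (hD : ∀ p q, total l (p + 1) q = 0) :
    ∃ k : ∀ p q, BiCochain G V p q, (∀ p q, k p q ∈ biCochains G V p q) ∧
      ∃ f : ∀ q, Cochain G V q, (∀ q, f q ∈ (kcgEq G G V).carrier q) ∧
        l = fun p q => total k p q + rightFamily f p q := by
  have hflip : ∀ (k : ∀ p q, biCochains G V p q) p q,
      horizontal (A := fun p q => biCochains G V q p) (fun p q => restrictedDiffR G V q p)
        (fun p q => k q p) q p = vertical (restrictedDiffR G V) k p q := fun k p q => by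
    cases q <;> rfl
  have vflip : ∀ (k : ∀ p q, biCochains G V p q) p q,
      vertical (A := fun p q => biCochains G V q p) (fun p q => restrictedDiffL G V q p)
        (fun p q => k q p) q p = horizontal (restrictedDiffL G V) k p q := fun k p q => by
    cases p <;> rfl
  obtain ⟨k, hk, hk0⟩ := exists_eq_total_differential
    (A := fun p q => biCochains G V q p)
    (h := fun p q => restrictedDiffR G V q p) (v := fun p q => restrictedDiffL G V q p)
    (fun p q a => Subtype.ext (diffR_diffR a.1))
    (fun p q a => Subtype.ext ((add_comm _ _).trans (diffL_diffR a.1)))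
    (fun p q a ha => by
      obtain ⟨b, hb, hba⟩ := exists_diffL_eq a.2 (congrArg Subtype.val ha)
      exact ⟨⟨b, hb⟩, Subtype.ext hba⟩)
    (fun p q => ⟨l q p, hl q p⟩)
    (fun q p => Subtype.ext (by
      rw [hflip (fun p q => ⟨l p q, hl p q⟩), vflip (fun p q => ⟨l p q, hl p q⟩),
        AddSubgroup.coe_add, coe_horizontal, coe_vertical]
      exact (add_comm _ _).trans (hD p q)))
  have hk' : ∀ q p, l (p + 1) q = total (fun p q => (k q p : BiCochain G V p q)) (p + 1) q := by
    intro q p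
    have h1 := congrArg Subtype.val (hk q p)
    rw [hflip (fun p q => k q p), vflip (fun p q => k q p), AddSubgroup.coe_add, coe_horizontal,
      coe_vertical] at h1
    exact h1.trans (add_comm _ _)
  simp only [hflip (fun p q => k q p)] at hk0
  choose f hf hfl using fun q => exists_eq_right
    (f := l 0 q - (vertical (restrictedDiffR G V) (fun p q => k q p) 0 q).1)
    (sub_mem (hl 0 q) (vertical (restrictedDiffR G V) (fun p q => k q p) 0 q).2)
    (congrArg Subtype.val (hk0 q))
  refine ⟨fun p q => k q p, fun p q => (k q p).2, f, hf, funext fun p => funext fun q => ?_⟩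
  cases p with
  | zero =>
    have h1 : l 0 q - (vertical (restrictedDiffR G V) (fun p q => k q p) 0 q).1 =
      rightFamily f 0 q := funext fun z => hfl q z.1 z.2
    rw [← h1, coe_vertical]
    simp [total, horizontal]
  | succ p => exact (hk' q p).trans (add_zero _).symm

theorem leftFamily_mem {F : ∀ p, Cochain G V p} (hF : ∀ p, F p ∈ (kcEq G G V).carrier p)
    (p q : ℕ) : leftFamily F p q ∈ biCochains G V p q := by
  cases q with
  | zero => exact left_mem (hF p)
  | succ q => exact zero_mem _

theorem rightFamily_mem {f : ∀ q, Cochain G V q} (hf : ∀ q, f q ∈ (kcgEq G G V).carrier q)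
    (p q : ℕ) : rightFamily f p q ∈ biCochains G V p q := by
  cases p with
  | zero => exact right_mem (hf q)
  | succ p => exact zero_mem _

/-- The family on the `y`-edge is moved to the `x`-edge by exact columns; Alexander–Whitney turns
this relation into one between cochains on `G`. -/
theorem exists_kcEq_cohomologous
    (exact : ∀ p q, ∀ f ∈ biCochains G V p (q + 1), diffR p (q + 1) f = 0 →
      ∃ b ∈ biCochains G V p q, diffR p q b = f)
    {f : ∀ q, Cochain G V q} (hf : ∀ q, f q ∈ (kcgEq G G V).carrier q)
    (hdf : ∀ q, diff G V q (f q) = 0) :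
    ∃ F : ∀ p, Cochain G V p, (∀ p, F p ∈ (kcEq G G V).carrier p) ∧ f 0 = F 0 ∧
      ∀ n, ∃ w ∈ (kcgEq G G V).carrier n, diff G V n w = f (n + 1) - F (n + 1) := by
  obtain ⟨k, hk, F, hF, h⟩ := exists_eq_total_add_leftFamily exact (rightFamily_mem hf)
    (fun p q => by
      cases p with
      | zero => rw [total_rightFamily_zero_succ, hdf]; rfl
      | succ p => exact total_rightFamily_succ f p _)
  have h1 : ∀ n, f n = alexanderWhitney (total k) n + F n := fun n => by
    rw [← alexanderWhitney_rightFamily f, h, alexanderWhitney_add, alexanderWhitney_leftFamily]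
  refine ⟨F, hF, ?_, fun n => ⟨_, alexanderWhitney_mem hk n, ?_⟩⟩
  · rw [h1 0]
    exact (congrArg (· + F 0) (alexanderWhitney_total_zero k)).trans (zero_add _)
  · rw [h1 (n + 1), add_sub_cancel_right]
    exact (alexanderWhitney_total_succ k n).symm

/-- Exact rows move `F` to some `f'` on the `y`-edge, which bounds there because `F` does. So `F`
bounds in the total complex, and exact columns push the bounding family back to the `x`-edge. -/
theorem exists_kcEq_of_coboundary
    (exact : ∀ p q, ∀ f ∈ biCochains G V p (q + 1), diffR p (q + 1) f = 0 →
      ∃ b ∈ biCochains G V p q, diffR p q b = f)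
    {F : ∀ p, Cochain G V p} (hF : ∀ p, F p ∈ (kcEq G G V).carrier p)
    {f : ∀ q, Cochain G V q} (hf : ∀ q, f q ∈ (kcgEq G G V).carrier q) (hF0 : F 0 = 0)
    (hFf : ∀ n, F (n + 1) = diff G V n (f n)) (n : ℕ) :
    ∃ K ∈ (kcEq G G V).carrier n, diff G V n K = F (n + 1) := by
  have hdF : ∀ p, diff G V p (F p) = 0 := fun p => by
    cases p with
    | zero => rw [hF0, map_zero]
    | succ p => rw [hFf, diff_diff]
  obtain ⟨k, hk, f', hf', h⟩ := exists_eq_total_add_rightFamily (leftFamily_mem hF)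
    (fun p q => by
      cases q with
      | zero => rw [total_leftFamily_succ_zero, hdF]; rfl
      | succ q => exact total_leftFamily_succ F _ q)
  have h1 : ∀ n, F n = alexanderWhitney (total k) n + f' n := fun n => by
    rw [← alexanderWhitney_leftFamily F, h, alexanderWhitney_add, alexanderWhitney_rightFamily]
  have h2 : f' 0 = 0 := by
    rw [← hF0, h1 0]
    exact ((congrArg (· + f' 0) (alexanderWhitney_total_zero k)).trans (zero_add _)).symm
  -- Alexander–Whitney shows that `F` and `f'` differ by the coboundary of the image of `k`;
  -- correcting `f` by that image gives a primitive of `f'`.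
  let w : ∀ q, Cochain G V q := fun q => f q - alexanderWhitney k q
  have hw : ∀ q, w q ∈ (kcgEq G G V).carrier q := fun q =>
    sub_mem (hf q) (alexanderWhitney_mem hk q)
  have h3 : ∀ n, f' (n + 1) = diff G V n (w n) := fun n => by
    rw [map_sub, ← hFf, h1 (n + 1), ← alexanderWhitney_total_succ]
    exact (add_sub_cancel_left _ _).symm
  have h4 : rightFamily f' = total (rightFamily w) := by
    funext p q
    cases p with
    | zero =>
      cases q with
      | zero =>
        rw [total_rightFamily_zero_zero]
        exact funext fun z => congrFun h2 z.2
      | succ q =>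
        rw [total_rightFamily_zero_succ, ← h3]
        rfl
    | succ p => exact (total_rightFamily_succ w p q).symm
  have h5 : ∀ p q, leftFamily F p q = total (fun p q => k p q + rightFamily w p q) p q := by
    intro p q
    rw [total_add, ← h4, h]
  obtain ⟨k', -, K, hK, h6⟩ := exists_eq_total_add_leftFamily exact
    (fun p q => add_mem (hk p q) (rightFamily_mem hw p q)) (fun p q => (h5 p (q + 1)).symm)
  refine ⟨K n, hK n, ?_⟩
  have h7 := h5 (n + 1) 0
  rw [h6, total_add, total_total_succ_zero, zero_add, total_leftFamily_succ_zero] at h7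
  funext x
  exact (congrFun h7 (x, fun _ => x 0)).symm

theorem isIso_HkcToHkcg
    (exact : ∀ p q, ∀ f ∈ biCochains G V p (q + 1), diffR p (q + 1) f = 0 →
      ∃ b ∈ biCochains G V p q, diffR p q b = f) (n : ℕ) : IsIso (HkcToHkcg G G V n) := by
  refine Subcomplex.isIso_homologyMap_inclusion _ n (fun f hf hdf => ?_) fun F hF hFb => ?_
  -- The transfer treats all degrees at once, so the given cocycle is extended by zero to the other
  -- degrees.
  · obtain ⟨F, hF, h0, hs⟩ := exists_kcEq_cohomologous exact (single_mem hf) (fun q => by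
      by_cases h : q = n
      · subst h
        rwa [Pi.single_eq_same]
      · rw [Pi.single_eq_of_ne h, map_zero])
    refine ⟨F n, hF n, ?_⟩
    cases n with
    | zero =>
      rw [Pi.single_eq_same] at h0
      subst h0
      exact ⟨hdf, sub_self _⟩
    | succ n =>
      obtain ⟨w, hw, h⟩ := hs n
      rw [Pi.single_eq_same] at h
      refine ⟨?_, w, hw, h⟩
      rw [← sub_sub_cancel f (F (n + 1)), ← h, map_sub, hdf, diff_diff, sub_zero]
  · cases n with
    | zero => exact hFb
    | succ n =>
      obtain ⟨g, hg, rfl⟩ := hFb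
      obtain ⟨K, hK, h⟩ := exists_kcEq_of_coboundary exact (single_mem hF) (single_mem hg)
        (Pi.single_eq_of_ne (Nat.succ_ne_zero n).symm _) (fun m => by
          by_cases h : m = n
          · subst h
            rw [Pi.single_eq_same, Pi.single_eq_same]
          · rw [Pi.single_eq_of_ne h, Pi.single_eq_of_ne (fun h' => h (Nat.succ_injective h')),
              map_zero]) n
      rw [Pi.single_eq_same] at h
      exact ⟨K, hK, h⟩

end Comparison

end KCohomology

theorem mainTheorem4 {G V : Type u} [Group G] [TopologicalSpace G] [IsTopologicalGroup G]
    [ContractibleSpace G]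
    (hG : TopologicalSpace.MetrizableSpace G ∨ LocallyCompactSpace G ∨
      (T2Space G ∧ KCohomology.IsKOmegaSpace G))
    [AddCommGroup V] [TopologicalSpace V] [KCohomology.IsKAddGroup V]
    [DistribMulAction G V] [KCohomology.IsKModule G V]
    (n : ℕ) :
    IsIso (KCohomology.HkcToHkcg G G V n) :=
  KCohomology.isIso_HkcToHkcg (fun p _ _ hf h =>
    KCohomology.exists_diffR_eq
      (KCohomology.hasStepFunctions_of_contractible_group hG (p + 1)) hf h) n
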